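/- Let $|\theta_0|<1$, let $\tau_1,\tau_2,\dots>0$ be known constants, and let $X_t=\theta_0X_{t-1}+\tau_t\varepsilon_t$ for $t\ge 1$, where $\varepsilon_1,\varepsilon_2,\dots$ are i.i.d. with mean $0$ and variance $1$, $\varepsilon_t$ is independent of $(X_0,\dots,X_{t-1})$ for every $t\ge 1$, and all moments of $X_0$ are finite. For each $n$ let $\hat\theta_1=\hat\theta_{1,n}$ be a weighted least-squares estimator, i.e. a random variable that almost surely minimizes $$\theta\mapsto\frac1n\sum_{t=2}^n\frac1{\tau_t^2}(X_t-\theta X_{t-1})^2$$ (so that $\hat\theta_1=\sum_{t=2}^n\tau_t^{-2}X_tX_{t-1}\big/\sum_{t=2}^n\tau_t^{-2}X_{t-1}^2$ whenever the denominator is nonzero), and let $s_n\ge 0$ be given by $s_n^2=\sum_{t=2}^n\tau_t^{-2}E[X_{t-1}^2]$. Consider the following conditions. (A1) There is a constant $M_2$ such that $\tau_i/\tau_j\le M_2$ for all $1\le i<j$. (A2) There is a constant $M_1>0$ such that $\frac1n\sum_{1\le i<j\le n}\theta_0^{2(j-i)}(\tau_i/\tau_j)^2\ge M_1$ for all sufficiently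 large $n$. (A3) $\frac1n\sum_{1\le i<j\le n}\theta_0^{2(j-i)}(\tau_i/\tau_j)^2\to\rho^2$ as $n\to\infty$, for a real number $\rho$. If (A1) and (A2) hold, then $s_n(\hat\theta_1-\theta_0)\xrightarrow{d}N(0,1)$ as $n\to\infty$. If in addition (A3) holds, then $\sqrt n(\hat\theta_1-\theta_0)\xrightarrow{d}N(0,\theta_0^2/\rho^2)$ as $n\to\infty$. -/

import Mathlib

open MeasureTheory ProbabilityTheory Filter Topology

noncomputable section

/-- The heteroscedastic AR(1) model `X_t = θ₀ X_{t-1} + τ_t ε_t`, `t = 1, 2, …`, with `|θ₀| < 1`,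
constants `τ_t > 0`, i.i.d. innovations `ε_1, ε_2, …` of mean `0` and variance `1`, each `ε_t`
being independent of the past `(X_0, …, X_{t-1})`, and an initial value `X_0` with all moments
finite. The values `τ 0` and `ε 0` play no role. -/
structure IsHeteroscedasticAR1 {Ω : Type*} [MeasurableSpace Ω] (μ : Measure Ω)
    (θ₀ : ℝ) (τ : ℕ → ℝ) (ε X : ℕ → Ω → ℝ) : Prop where
  abs_theta_lt_one : |θ₀| < 1
  tau_pos : ∀ t, 1 ≤ t → 0 < τ t
  measurable_eps : ∀ t, 1 ≤ t → Measurable (ε t)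
  measurable_X : ∀ t, Measurable (X t)
  iIndepFun_eps : iIndepFun (fun t : ℕ ↦ ε (t + 1)) μ
  identDistrib_eps : ∀ t, 1 ≤ t → IdentDistrib (ε t) (ε 1) μ μ
  memLp_eps : MemLp (ε 1) 2 μ
  mean_eps : ∫ ω, ε 1 ω ∂μ = 0
  variance_eps : variance (ε 1) μ = 1
  memLp_X_zero : ∀ k : ℕ, MemLp (X 0) (k : ENNReal) μ
  indepFun_past : ∀ t, 1 ≤ t → IndepFun (ε t) (fun ω (k : Fin t) ↦ X k ω) μ
  recursion : ∀ t, ∀ᵐ ω ∂μ, X (t + 1) ω = θ₀ * X t ω + τ (t + 1) * ε (t + 1) ω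

/-- The weighted least squares criterion
`θ ↦ (1/n) ∑_{t=2}^n τ_t⁻² (x_t - θ x_{t-1})²` of the observations `x`. -/
def wlsCriterion (τ x : ℕ → ℝ) (n : ℕ) (θ : ℝ) : ℝ :=
  1 / (n : ℝ) * ∑ t ∈ Finset.Icc 2 n, 1 / τ t ^ 2 * (x t - θ * x (t - 1)) ^ 2

/-- `θhat` is a sequence of weighted least squares estimators: for every `n`, `θhat n` is a random
variable which almost surely is a global minimizer of the weighted least squares criterion.
(The minimizer is unique unless `x_1, …, x_{n-1}` all vanish.) -/
structure IsWLSEstimator {Ω : Type*} [MeasurableSpace Ω] (μ : Measure Ω)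
    (τ : ℕ → ℝ) (X : ℕ → Ω → ℝ) (θhat : ℕ → Ω → ℝ) : Prop where
  aemeasurable : ∀ n, AEMeasurable (θhat n) μ
  minimizes : ∀ n, ∀ᵐ ω ∂μ, ∀ θ : ℝ,
    wlsCriterion τ (fun t ↦ X t ω) n (θhat n ω) ≤ wlsCriterion τ (fun t ↦ X t ω) n θ

/-- The normalization `s_n`, with `s_n² = ∑_{t=2}^n τ_t⁻² E[X_{t-1}²]`. -/
def sNorm {Ω : Type*} [MeasurableSpace Ω] (μ : Measure Ω)
    (τ : ℕ → ℝ) (X : ℕ → Ω → ℝ) (n : ℕ) : ℝ :=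
  Real.sqrt (∑ t ∈ Finset.Icc 2 n, 1 / τ t ^ 2 * ∫ ω, X (t - 1) ω ^ 2 ∂μ)

/-- `(1/n) ∑_{1 ≤ i < j ≤ n} θ₀^{2(j-i)} (τ_i/τ_j)²`. -/
def ratioAverage (θ₀ : ℝ) (τ : ℕ → ℝ) (n : ℕ) : ℝ :=
  1 / (n : ℝ) * ∑ j ∈ Finset.Icc 1 n, ∑ i ∈ Finset.Ico 1 j,
    θ₀ ^ (2 * (j - i)) * (τ i / τ j) ^ 2

end

/-! Put `σ t = τ (t + 1)`, let `ζ t` be the innovation entering `X (t + 1)`, and let `Q n = s_n²`.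
The normal equation writes the estimation error as `N / V`, with `N = ∑ (X t / σ t) ζ t` and `V = ∑
(X t / σ t)²`, both over `1 ≤ t < n`. Hence `s_n` times the error is `(N / √Q) / (V / Q)`. By
Slutsky's theorem it is enough that `V / Q → 1` in probability and `N / √Q → N(0,1)` in
distribution.

Law of large numbers (`IsAdaptedAR1.tendsto_integral_abs_sum_sub_div`): squaring the recursion gives
a linear recursion for `X t ^ 2`. Solving it splits `V - Q` into a contribution of `X 0`, a weighted
sum of `ζ² - 1`, and a martingale transform of `ζ`. By (A1) the weights are bounded. The innovations
have only two moments, so the second piece is treated by truncation, the third by orthogonality; all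
three are `o(n)` in mean, whereas (A2) makes `Q n` at least a multiple of `n`.

Central limit theorem (`IsInnovation.tendstoInDistribution_sum_mul`): for a transform `∑ Y t * ζ t`
of i.i.d. innovations, the variable `exp(∑ Y² / 2 + i ∑ Y ζ)` has mean close to `1`, since each new
factor has conditional mean `φ(Y) exp(Y² / 2)`, where `φ` is the characteristic function of `ζ`.
Stopping `Y` keeps this variable bounded, and `∑ Y² → 1` then yields the Gaussian characteristic
function. The Lindeberg condition follows from uniform integrability of `(X t / σ t)²`
(`IsAdaptedAR1.exists_setIntegral_div_sq_le`), a consequence of `|θ| < 1` and (A1).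

The second claim is a change of scale: up to a bounded term, `Q n` equals `n / θ₀²` times the
average in (A3), so `Q n / n → ρ² / θ₀²`. -/

noncomputable section

/-! ### Innovations and the orthogonality of their martingale transforms -/

/-- A sequence `ζ` of identically distributed random variables such that `ζ t` is revealed at time
`t + 1` and independent of the past up to time `t`. -/
structure IsInnovation {Ω : Type*} {mΩ : MeasurableSpace Ω} (μ : Measure Ω)
    (ℱ : Filtration ℕ mΩ) (ζ : ℕ → Ω → ℝ) : Prop where
  measurable_succ : ∀ t, Measurable[ℱ (t + 1)] (ζ t)
  indep : ∀ t, Indep (ℱ t) (MeasurableSpace.comap (ζ t) inferInstance) μ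
  identDistrib : ∀ t, IdentDistrib (ζ t) (ζ 0) μ μ

namespace IsInnovation

variable {Ω : Type*} {mΩ : MeasurableSpace Ω} {μ : Measure Ω} {ℱ : Filtration ℕ mΩ}
  {ζ : ℕ → Ω → ℝ}

lemma measurable (h : IsInnovation μ ℱ ζ) (t : ℕ) : Measurable (ζ t) :=
  (h.measurable_succ t).mono (ℱ.le _) le_rfl

lemma comp (h : IsInnovation μ ℱ ζ) {g : ℝ → ℝ} (hg : Measurable g) :
    IsInnovation μ ℱ (fun t ω ↦ g (ζ t ω)) where
  measurable_succ t := hg.comp (h.measurable_succ t)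
  indep t := by
    refine indep_of_indep_of_le_right (h.indep t) ?_
    rw [show (fun ω ↦ g (ζ t ω)) = g ∘ ζ t from rfl, ← MeasurableSpace.comap_comp]
    exact MeasurableSpace.comap_mono hg.comap_le
  identDistrib t := (h.identDistrib t).comp hg

lemma indepFun (h : IsInnovation μ ℱ ζ) {β : Type*} [MeasurableSpace β] {t : ℕ} {Y : Ω → β}
    (hY : Measurable[ℱ t] Y) : IndepFun Y (ζ t) μ := by
  rw [IndepFun_iff_Indep]
  exact indep_of_indep_of_le_left (h.indep t) hY.comap_le

lemma memLp (h : IsInnovation μ ℱ ζ) {p : ENNReal} (h2 : MemLp (ζ 0) p μ) (t : ℕ) :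
    MemLp (ζ t) p μ := (h.identDistrib t).memLp_iff.2 h2

lemma integral_eq (h : IsInnovation μ ℱ ζ) (t : ℕ) : ∫ ω, ζ t ω ∂μ = ∫ ω, ζ 0 ω ∂μ :=
  (h.identDistrib t).integral_eq

lemma integral_sq_eq (h : IsInnovation μ ℱ ζ) (t : ℕ) :
    ∫ ω, ζ t ω ^ 2 ∂μ = ∫ ω, ζ 0 ω ^ 2 ∂μ :=
  ((h.identDistrib t).comp (measurable_id.pow_const 2)).integral_eq

lemma memLp_mul (h : IsInnovation μ ℱ ζ) (h2 : MemLp (ζ 0) 2 μ) {t : ℕ} {Y : Ω → ℝ}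
    (hY : Measurable[ℱ t] Y) (hY2 : MemLp Y 2 μ) : MemLp (fun ω ↦ Y ω * ζ t ω) 2 μ := by
  have hm : Measurable Y := hY.mono (ℱ.le _) le_rfl
  have hmζ := h.measurable t
  rw [memLp_two_iff_integrable_sq (by fun_prop)]
  have hi := ((h.indepFun hY).comp (measurable_id.pow_const 2)
    (measurable_id.pow_const 2)).integrable_mul hY2.integrable_sq (h.memLp h2 t).integrable_sq
  refine hi.congr (ae_of_all _ fun ω ↦ ?_)
  simp [mul_pow]

lemma integral_mul_eq_zero (h : IsInnovation μ ℱ ζ) (h0 : ∫ ω, ζ 0 ω ∂μ = 0) {t : ℕ}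
    {Y : Ω → ℝ} (hY : Measurable[ℱ t] Y) : ∫ ω, Y ω * ζ t ω ∂μ = 0 := by
  have hm : Measurable Y := hY.mono (ℱ.le _) le_rfl
  rw [(h.indepFun hY).integral_fun_mul_eq_mul_integral hm.aestronglyMeasurable
    (h.measurable t).aestronglyMeasurable, h.integral_eq, h0, mul_zero]

lemma integral_sq_mul (h : IsInnovation μ ℱ ζ) {t : ℕ}
    {Y : Ω → ℝ} (hY : Measurable[ℱ t] Y) :
    ∫ ω, (Y ω * ζ t ω) ^ 2 ∂μ = (∫ ω, Y ω ^ 2 ∂μ) * ∫ ω, ζ 0 ω ^ 2 ∂μ := by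
  have hm : Measurable Y := hY.mono (ℱ.le _) le_rfl
  have hmζ := h.measurable t
  have hi : IndepFun (fun ω ↦ Y ω ^ 2) (fun ω ↦ ζ t ω ^ 2) μ :=
    (h.indepFun hY).comp (measurable_id.pow_const 2) (measurable_id.pow_const 2)
  rw [← h.integral_sq_eq t, ← hi.integral_fun_mul_eq_mul_integral (by fun_prop) (by fun_prop)]
  simp [mul_pow]

lemma measurable_sum_mul (h : IsInnovation μ ℱ ζ) {a : ℕ → Ω → ℝ}
    (ha : ∀ t, Measurable[ℱ t] (a t)) (n : ℕ) :
    Measurable[ℱ n] (fun ω ↦ ∑ t ∈ Finset.range n, a t ω * ζ t ω) := by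
  refine Finset.measurable_fun_sum _ fun t ht ↦ ?_
  rw [Finset.mem_range] at ht
  exact ((ha t).mono (ℱ.mono ht.le) le_rfl).mul
    ((h.measurable_succ t).mono (ℱ.mono ht) le_rfl)

lemma memLp_sum_mul (h : IsInnovation μ ℱ ζ) (h2 : MemLp (ζ 0) 2 μ) {a : ℕ → Ω → ℝ}
    (ha : ∀ t, Measurable[ℱ t] (a t)) (ha2 : ∀ t, MemLp (a t) 2 μ) (n : ℕ) :
    MemLp (fun ω ↦ ∑ t ∈ Finset.range n, a t ω * ζ t ω) 2 μ :=
  memLp_finsetSum _ fun t _ ↦ h.memLp_mul h2 (ha t) (ha2 t)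

/-- The martingale transforms of centered innovations have orthogonal increments. -/
lemma integral_sq_sum_mul (h : IsInnovation μ ℱ ζ) (h2 : MemLp (ζ 0) 2 μ)
    (h0 : ∫ ω, ζ 0 ω ∂μ = 0) {a : ℕ → Ω → ℝ}
    (ha : ∀ t, Measurable[ℱ t] (a t)) (ha2 : ∀ t, MemLp (a t) 2 μ) (n : ℕ) :
    ∫ ω, (∑ t ∈ Finset.range n, a t ω * ζ t ω) ^ 2 ∂μ
      = (∑ t ∈ Finset.range n, ∫ ω, a t ω ^ 2 ∂μ) * ∫ ω, ζ 0 ω ^ 2 ∂μ := by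
  induction n with
  | zero => simp
  | succ n ih =>
    have hS := h.memLp_sum_mul h2 ha ha2 n
    have hY := h.memLp_mul h2 (ha n) (ha2 n)
    have hSm := h.measurable_sum_mul ha n
    have hcross : ∫ ω, (∑ t ∈ Finset.range n, a t ω * ζ t ω) * (a n ω * ζ n ω) ∂μ = 0 := by
      simpa only [Pi.mul_apply, mul_assoc] using h.integral_mul_eq_zero h0 (hSm.mul (ha n))
    have hi := hS.integrable_mul hY
    simp_rw [Finset.sum_range_succ, add_sq, mul_assoc]
    rw [integral_add, integral_add, ih, h.integral_sq_mul (ha n), integral_const_mul, hcross]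
    · ring
    · exact hS.integrable_sq
    · exact hi.const_mul 2
    · exact hS.integrable_sq.add (hi.const_mul 2)
    · exact hY.integrable_sq

end IsInnovation

/-! ### Weighted law of large numbers and uniform integrability -/

lemma integral_abs_le_sqrt_integral_sq {Ω : Type*} {mΩ : MeasurableSpace Ω} {μ : Measure Ω}
    [IsProbabilityMeasure μ] {f : Ω → ℝ} (hf : MemLp f 2 μ) :
    ∫ ω, |f ω| ∂μ ≤ √(∫ ω, f ω ^ 2 ∂μ) := by
  refine Real.le_sqrt_of_sq_le ?_
  have := variance_nonneg |f| μ
  rw [variance_eq_sub hf.abs] at this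
  simpa [Pi.abs_def] using this

/-- A weighted weak law of large numbers, in mean, with triangular arrays of bounded weights. -/
lemma IsInnovation.tendsto_integral_abs_weighted_sum_div
    {Ω : Type*} {mΩ : MeasurableSpace Ω} {μ : Measure Ω} {ℱ : Filtration ℕ mΩ}
    {ζ : ℕ → Ω → ℝ} [IsProbabilityMeasure μ] (h : IsInnovation μ ℱ ζ) (hint : Integrable (ζ 0) μ)
    (h0 : ∫ ω, ζ 0 ω ∂μ = 0) {a : ℕ → ℕ → ℝ} {C : ℝ} (ha : ∀ n t, |a n t| ≤ C) :
    Tendsto (fun n : ℕ ↦ (∫ ω, |∑ t ∈ Finset.range n, a n t * ζ t ω| ∂μ) / n) atTop (𝓝 0) := by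
  have hC : 0 ≤ C := (abs_nonneg _).trans (ha 0 0)
  -- Split `ζ = (g(ζ) - m) + (ζ - g(ζ) + m)`, where `g` is bounded continuous with `E|ζ - g(ζ)| ≤ δ`
  -- and `m = E g(ζ)`, so that `|m| ≤ δ`. The first part is centered and square integrable, and
  -- orthogonality gives the square root; the second costs at most `2 * δ` per term, up to the
  -- weight.
  have key : ∀ δ > 0, ∃ B, ∀ n : ℕ,
      ∫ ω, |∑ t ∈ Finset.range n, a n t * ζ t ω| ∂μ ≤ √(n * B) + n * (C * (2 * δ)) := by
    intro δ hδ
    have hid : Integrable id (μ.map (ζ 0)) := by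
      rw [integrable_map_measure measurable_id.aestronglyMeasurable (h.measurable 0).aemeasurable]
      simpa using hint
    have := Measure.isProbabilityMeasure_map (μ := μ) (h.measurable 0).aemeasurable
    obtain ⟨g, hg, -⟩ := hid.exists_boundedContinuous_integral_sub_le hδ
    have hgm : Measurable g := g.continuous.measurable
    rw [integral_map (h.measurable 0).aemeasurable (by fun_prop)] at hg
    simp only [id, Real.norm_eq_abs] at hg
    set m := ∫ ω, g (ζ 0 ω) ∂μ with hm
    have hmζ := h.measurable
    have hgi : Integrable (fun ω ↦ g (ζ 0 ω)) μ :=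
      Integrable.of_bound (by fun_prop) ‖g‖ (ae_of_all _ fun ω ↦ g.norm_coe_le_norm _)
    have hmδ : |m| ≤ δ := by
      have : m = -∫ ω, (ζ 0 ω - g (ζ 0 ω)) ∂μ := by rw [integral_sub hint hgi, h0]; simp [hm]
      rw [this, abs_neg]
      exact (abs_integral_le_integral_abs).trans hg
    have h1 : IsInnovation μ ℱ (fun t ω ↦ g (ζ t ω) - m) :=
      h.comp (g := fun x ↦ g x - m) (by fun_prop)
    have h1L : MemLp (fun ω ↦ g (ζ 0 ω) - m) 2 μ :=
      MemLp.of_bound (by fun_prop) (‖g‖ + |m|) (ae_of_all _ fun ω ↦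
        (norm_sub_le _ _).trans (add_le_add (g.norm_coe_le_norm _) le_rfl))
    have h10 : ∫ ω, (g (ζ 0 ω) - m) ∂μ = 0 := by
      rw [integral_sub hgi (integrable_const _)]; simp [hm]
    have h2 : IsInnovation μ ℱ (fun t ω ↦ ζ t ω - g (ζ t ω) + m) :=
      h.comp (g := fun x ↦ x - g x + m) (by fun_prop)
    have h2i : Integrable (fun ω ↦ ζ 0 ω - g (ζ 0 ω) + m) μ :=
      (hint.sub hgi).add (integrable_const _)
    have h2a : ∀ t, Integrable (fun ω ↦ ζ t ω - g (ζ t ω) + m) μ := fun t ↦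
      (h2.identDistrib t).integrable_iff.2 h2i
    have h2b : ∀ t, ∫ ω, |ζ t ω - g (ζ t ω) + m| ∂μ ≤ 2 * δ := by
      intro t
      rw [show ∫ ω, |ζ t ω - g (ζ t ω) + m| ∂μ = ∫ ω, |ζ 0 ω - g (ζ 0 ω) + m| ∂μ from
        ((h2.identDistrib t).comp measurable_id.abs).integral_eq]
      calc ∫ ω, |ζ 0 ω - g (ζ 0 ω) + m| ∂μ ≤ ∫ ω, (|ζ 0 ω - g (ζ 0 ω)| + |m|) ∂μ :=
            integral_mono h2i.abs ((hint.sub hgi).abs.add (integrable_const _))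
              fun ω ↦ abs_add_le _ _
        _ ≤ 2 * δ := by
            have hd : Integrable (fun ω ↦ |ζ 0 ω - g (ζ 0 ω)|) μ := (hint.sub hgi).abs
            rw [integral_add hd (integrable_const _)]
            simp; linarith
    refine ⟨C ^ 2 * ∫ ω, (g (ζ 0 ω) - m) ^ 2 ∂μ, fun n ↦ ?_⟩
    have hac : ∀ t, Measurable[ℱ t] (fun _ : Ω ↦ a n t) := fun t ↦ measurable_const
    have hal : ∀ t, MemLp (fun _ : Ω ↦ a n t) 2 μ := fun t ↦ memLp_const _
    have hS1 := h1.memLp_sum_mul h1L hac hal n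
    have hS2 : Integrable (fun ω ↦ ∑ t ∈ Finset.range n, C * |ζ t ω - g (ζ t ω) + m|) μ :=
      integrable_finsetSum _ fun t _ ↦ (h2a t).abs.const_mul C
    calc ∫ ω, |∑ t ∈ Finset.range n, a n t * ζ t ω| ∂μ
        ≤ ∫ ω, (|∑ t ∈ Finset.range n, a n t * (g (ζ t ω) - m)|
            + ∑ t ∈ Finset.range n, C * |ζ t ω - g (ζ t ω) + m|) ∂μ := by
          refine integral_mono_of_nonneg (ae_of_all _ fun ω ↦ abs_nonneg _)
            ((hS1.integrable (by norm_num)).abs.add hS2) (ae_of_all _ fun ω ↦ ?_)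
          have : ∑ t ∈ Finset.range n, a n t * ζ t ω
              = ∑ t ∈ Finset.range n, a n t * (g (ζ t ω) - m)
                + ∑ t ∈ Finset.range n, a n t * (ζ t ω - g (ζ t ω) + m) := by
            rw [← Finset.sum_add_distrib]
            exact Finset.sum_congr rfl fun t _ ↦ by ring
          simp only [this]
          refine (abs_add_le _ _).trans (add_le_add le_rfl ?_)
          refine (Finset.abs_sum_le_sum_abs _ _).trans (Finset.sum_le_sum fun t _ ↦ ?_)
          rw [abs_mul]
          exact mul_le_mul_of_nonneg_right (ha n t) (abs_nonneg _)
      _ ≤ _ := by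
          rw [integral_add (hS1.integrable (by norm_num)).abs hS2]
          refine add_le_add ((integral_abs_le_sqrt_integral_sq hS1).trans (Real.sqrt_le_sqrt ?_)) ?_
          · rw [h1.integral_sq_sum_mul h1L h10 hac hal n, ← mul_assoc]
            refine mul_le_mul_of_nonneg_right ?_ (integral_nonneg fun ω ↦ sq_nonneg _)
            calc ∑ t ∈ Finset.range n, ∫ _, a n t ^ 2 ∂μ ≤ ∑ t ∈ Finset.range n, C ^ 2 := by
                  refine Finset.sum_le_sum fun t _ ↦ ?_
                  simpa using sq_le_sq.2 ((ha n t).trans (le_abs_self C))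
              _ = n * C ^ 2 := by simp
          · rw [integral_finsetSum _ fun t _ ↦ (h2a t).abs.const_mul C]
            calc _ ≤ ∑ t ∈ Finset.range n, C * (2 * δ) := by
                  refine Finset.sum_le_sum fun t _ ↦ ?_
                  rw [integral_const_mul]
                  exact mul_le_mul_of_nonneg_left (h2b t) hC
              _ = n * (C * (2 * δ)) := by simp
  rw [Metric.tendsto_nhds]
  intro e he
  -- This `δ` makes the linear term at most `n * (e / 2)`; `C + 1` guards against `C = 0`.
  obtain ⟨B, hB⟩ := key (e / (4 * (C + 1))) (by positivity)
  have hlim : Tendsto (fun n : ℕ ↦ √(B / n)) atTop (𝓝 0) := by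
    simpa using (tendsto_const_div_atTop_nhds_zero_nat B).sqrt
  filter_upwards [hlim.eventually_lt_const (show (0 : ℝ) < e / 2 by positivity),
    eventually_gt_atTop 0] with n hn hn0
  have hn0' : (0 : ℝ) < n := by exact_mod_cast hn0
  have hnn : 0 ≤ (∫ ω, |∑ t ∈ Finset.range n, a n t * ζ t ω| ∂μ) / n :=
    div_nonneg (integral_nonneg fun ω ↦ abs_nonneg _) hn0'.le
  rw [Real.dist_eq, sub_zero, abs_of_nonneg hnn, div_lt_iff₀ hn0']
  refine (hB n).trans_lt ?_
  have h1 : √(n * B) = n * √(B / n) := by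
    rw [show (n : ℝ) * B = n ^ 2 * (B / n) by field_simp, Real.sqrt_mul (by positivity),
      Real.sqrt_sq hn0'.le]
  have h2 : C * (2 * (e / (4 * (C + 1)))) ≤ e / 2 := by
    rw [show C * (2 * (e / (4 * (C + 1)))) = (C / (C + 1)) * (e / 2) by field_simp; ring]
    have : C / (C + 1) ≤ 1 := (div_le_one (by positivity)).2 (by linarith)
    nlinarith
  rw [h1]
  nlinarith

/-- Uniform integrability of the random variables with a given integrable law. -/
lemma MeasureTheory.Integrable.exists_forall_setIntegral_abs_le
    {Ω : Type*} {mΩ : MeasurableSpace Ω} {μ : Measure Ω} [IsProbabilityMeasure μ]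
    {f : Ω → ℝ} (hf : Integrable f μ) {δ : ℝ} (hδ : 0 < δ) :
    ∃ K, 0 ≤ K ∧ ∀ W : Ω → ℝ, IdentDistrib W f μ μ → ∀ E, MeasurableSet E →
      ∫ ω in E, |W ω| ∂μ ≤ δ + K * μ.real E := by
  have hid : Integrable id (μ.map f) := by
    rw [integrable_map_measure measurable_id.aestronglyMeasurable hf.aemeasurable]
    simpa using hf
  have := Measure.isProbabilityMeasure_map (μ := μ) hf.aemeasurable
  obtain ⟨g, hg, hgi⟩ := hid.exists_boundedContinuous_integral_sub_le hδ
  have hgm : Measurable g := g.continuous.measurable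
  refine ⟨‖g‖, norm_nonneg _, fun W hW E hE ↦ ?_⟩
  have hWi : Integrable W μ := hW.integrable_iff.2 hf
  rw [← hW.map_eq, integral_map hWi.aemeasurable (by fun_prop)] at hg
  have hgi : Integrable (fun ω ↦ W ω - g (W ω)) μ :=
    hWi.sub <| Integrable.of_bound (hgm.comp_aemeasurable hWi.aemeasurable).aestronglyMeasurable
      ‖g‖ (ae_of_all _ fun ω ↦ g.norm_coe_le_norm _)
  calc ∫ ω in E, |W ω| ∂μ ≤ ∫ ω in E, (|W ω - g (W ω)| + ‖g‖) ∂μ := by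
        refine integral_mono hWi.abs.integrableOn
          (hgi.abs.add (integrable_const _)).integrableOn fun ω ↦ ?_
        have h1 := abs_add_le (W ω - g (W ω)) (g (W ω))
        have h2 : |g (W ω)| ≤ ‖g‖ := g.norm_coe_le_norm _
        simp only [sub_add_cancel] at h1
        simp only
        linarith
    _ ≤ δ + ‖g‖ * μ.real E := by
        rw [integral_add hgi.abs.integrableOn (integrable_const _).integrableOn]
        refine add_le_add ?_ (by simp [mul_comm])
        exact (setIntegral_le_integral hgi.abs (ae_of_all _ fun ω ↦ abs_nonneg _)).trans hg

/-! ### Characteristic functions and compensated exponentials -/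

section CharFun

variable {Ω : Type*} {mΩ : MeasurableSpace Ω} {μ : Measure Ω} [IsProbabilityMeasure μ]

/-- Integrating out an independent random variable in an exponential. -/
lemma ProbabilityTheory.IndepFun.integral_mul_cexp_eq {g : Ω → ℂ} {y z : Ω → ℝ}
    (hind : IndepFun (fun ω ↦ (g ω, y ω)) z μ) (hg : Measurable g) (hy : Measurable y)
    (hz : Measurable z) (hgi : Integrable g μ) :
    ∫ ω, g ω * Complex.exp ((y ω * z ω : ℝ) * Complex.I) ∂μ
      = ∫ ω, g ω * charFun (μ.map z) (y ω) ∂μ := by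
  have hgy : Measurable (fun ω ↦ (g ω, y ω)) := hg.prodMk hy
  have hmap := (indepFun_iff_map_prod_eq_prod_map_map hgy.aemeasurable hz.aemeasurable).1 hind
  have := Measure.isProbabilityMeasure_map (μ := μ) hz.aemeasurable
  have := Measure.isProbabilityMeasure_map (μ := μ) hgy.aemeasurable
  let F : (ℂ × ℝ) × ℝ → ℂ := fun p ↦ p.1.1 * Complex.exp ((p.1.2 * p.2 : ℝ) * Complex.I)
  have hF : Measurable F := by
    have : Measurable fun p : (ℂ × ℝ) × ℝ ↦ ((p.1.2 * p.2 : ℝ) : ℂ) :=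
      Complex.measurable_ofReal.comp (by fun_prop)
    fun_prop
  have hFi : Integrable F ((μ.map fun ω ↦ (g ω, y ω)).prod (μ.map z)) := by
    rw [← hmap, integrable_map_measure hF.aestronglyMeasurable (hgy.prodMk hz).aemeasurable]
    refine hgi.mono (hF.comp (hgy.prodMk hz)).aestronglyMeasurable (ae_of_all _ fun ω ↦ ?_)
    simp only [F, Function.comp, norm_mul, Complex.norm_exp_ofReal_mul_I, mul_one, le_refl]
  calc ∫ ω, g ω * Complex.exp ((y ω * z ω : ℝ) * Complex.I) ∂μ
      = ∫ p, F p ∂(μ.map fun ω ↦ ((g ω, y ω), z ω)) := by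
        rw [integral_map (hgy.prodMk hz).aemeasurable hF.aestronglyMeasurable]
    _ = ∫ q, ∫ x, F (q, x) ∂(μ.map z) ∂(μ.map fun ω ↦ (g ω, y ω)) := by
        rw [hmap, integral_prod _ hFi]
    _ = ∫ q, q.1 * charFun (μ.map z) q.2 ∂(μ.map fun ω ↦ (g ω, y ω)) := by
        congr 1 with q
        simp only [F]
        rw [integral_const_mul, charFun_apply_real]
        simp
    _ = _ := by
        have hφ : Measurable (charFun (μ.map z)) := by fun_prop
        rw [integral_map hgy.aemeasurable (by fun_prop)]

/-- Bound on the deviation of a characteristic function from that of the standard Gaussian. -/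
lemma exists_norm_charFun_mul_exp_sub_one_le {z : Ω → ℝ} (hz : AEMeasurable z μ)
    (h0 : ∫ ω, z ω ∂μ = 0) (h1 : ∫ ω, z ω ^ 2 ∂μ = 1) (B : ℝ) {δ : ℝ} (hδ : 0 < δ) :
    ∃ η > 0, ∃ K ≥ 0, ∀ x : ℝ, x ^ 2 ≤ B →
      ‖charFun (μ.map z) x * Complex.exp ((x ^ 2 / 2 : ℝ)) - 1‖
        ≤ δ * x ^ 2 + K * (if η < |x| then x ^ 2 else 0) := by
  have := Measure.isProbabilityMeasure_map (μ := μ) hz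
  have hT := taylor_charFun_two hz h0 (by simpa using h1)
  -- Multiply the expansion `φ(t) = 1 - t²/2 + o(t²)` by `exp(t²/2)`: the error term stays `o(t²)`,
  -- and `(1 - t²/2) exp(t²/2) - 1` is `O(t⁴)`.
  have hE : (fun t : ℝ ↦ charFun (μ.map z) t * Complex.exp ((t ^ 2 / 2 : ℝ)) - 1)
      =o[𝓝 0] fun t : ℝ ↦ t ^ 2 := by
    have hb : (fun t : ℝ ↦ Complex.exp ((t ^ 2 / 2 : ℝ))) =O[𝓝 0] fun _ : ℝ ↦ (1 : ℝ) := by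
      have : Continuous fun t : ℝ ↦ Complex.exp ((t ^ 2 / 2 : ℝ)) := by fun_prop
      exact (this.tendsto 0).isBigO_one ℝ
    have hA : (fun t : ℝ ↦ (charFun (μ.map z) t - (1 - (t : ℂ) ^ 2 / 2)) *
        Complex.exp ((t ^ 2 / 2 : ℝ))) =o[𝓝 0] fun t : ℝ ↦ t ^ 2 := by
      simpa using hT.mul_isBigO hb
    have hR : (fun t : ℝ ↦ (((1 - t ^ 2 / 2) * Real.exp (t ^ 2 / 2) - 1 : ℝ) : ℂ))
        =O[𝓝 0] fun t : ℝ ↦ t ^ 4 := by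
      refine Asymptotics.IsBigO.of_bound 1 ?_
      filter_upwards [Metric.ball_mem_nhds (0 : ℝ) one_pos] with t ht
      rw [Metric.mem_ball, Real.dist_eq, sub_zero] at ht
      have ht2 : t ^ 2 ≤ 1 := by
        rw [← sq_abs]; exact pow_le_one₀ (abs_nonneg t) ht.le
      have hy := Real.abs_exp_sub_one_sub_id_le (x := t ^ 2 / 2)
        (by rw [abs_of_nonneg (by positivity)]; linarith)
      rw [Complex.norm_real, Real.norm_eq_abs, Real.norm_eq_abs, one_mul,
        abs_of_nonneg (show 0 ≤ t ^ 4 by positivity)]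
      rw [abs_le] at hy ⊢
      constructor <;> nlinarith [sq_nonneg t, sq_nonneg (t ^ 2)]
    have hR' := hR.trans_isLittleO
      (Asymptotics.isLittleO_pow_pow (𝕜 := ℝ) (show 2 < 4 by norm_num))
    refine (hA.add hR').congr_left fun t ↦ ?_
    push_cast
    ring
  obtain ⟨η, hη, hηb⟩ := Metric.eventually_nhds_iff.1 (hE.bound hδ)
  -- Halving `η` lets the closed range `|x| ≤ η / 2` lie in the open neighbourhood. Beyond it, the
  -- crude bound `exp(B/2) + 1` becomes a multiple of `x²` because `x² ≥ (η/2)²`.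
  refine ⟨η / 2, by positivity, (Real.exp (B / 2) + 1) / (η / 2) ^ 2, by positivity,
    fun x hx ↦ ?_⟩
  split_ifs with hxη
  · have hb : ‖charFun (μ.map z) x * Complex.exp ((x ^ 2 / 2 : ℝ)) - 1‖ ≤ Real.exp (B / 2) + 1 := by
      refine (norm_sub_le _ _).trans (add_le_add ?_ (by simp))
      rw [norm_mul, Complex.norm_exp_ofReal]
      calc _ ≤ 1 * Real.exp (B / 2) := by
            gcongr
            exact norm_charFun_le_one _
        _ = _ := one_mul _
    have h2 : (η / 2) ^ 2 ≤ x ^ 2 := sq_le_sq.2 (by rw [abs_of_pos (by positivity)]; exact hxη.le)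
    calc _ ≤ Real.exp (B / 2) + 1 := hb
      _ = (Real.exp (B / 2) + 1) / (η / 2) ^ 2 * (η / 2) ^ 2 := by field_simp
      _ ≤ (Real.exp (B / 2) + 1) / (η / 2) ^ 2 * x ^ 2 := by gcongr
      _ ≤ _ := le_add_of_nonneg_left (by positivity)
  · have := hηb (y := x) (by rw [Real.dist_eq, sub_zero]; linarith [not_lt.1 hxη])
    simpa using this

end CharFun

namespace IsInnovation

variable {Ω : Type*} {mΩ : MeasurableSpace Ω} {μ : Measure Ω} {ℱ : Filtration ℕ mΩ}
  {ζ : ℕ → Ω → ℝ}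

/-- The exponential of a martingale transform, compensated by its quadratic characteristic. -/
def compensatedExp (ζ Y : ℕ → Ω → ℝ) (n : ℕ) (ω : Ω) : ℂ :=
  Complex.exp ((∑ t ∈ Finset.range n, Y t ω ^ 2 / 2 : ℝ)) *
    Complex.exp ((∑ t ∈ Finset.range n, Y t ω * ζ t ω : ℝ) * Complex.I)

lemma norm_compensatedExp (Y : ℕ → Ω → ℝ) (n : ℕ) (ω : Ω) :
    ‖compensatedExp ζ Y n ω‖ = Real.exp (∑ t ∈ Finset.range n, Y t ω ^ 2 / 2) := by
  rw [compensatedExp, norm_mul, Complex.norm_exp_ofReal_mul_I, mul_one, Complex.norm_exp_ofReal]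

lemma measurable_compensatedExp (h : IsInnovation μ ℱ ζ) {Y : ℕ → Ω → ℝ}
    (hY : ∀ t, Measurable[ℱ t] (Y t)) (n : ℕ) : Measurable[ℱ n] (compensatedExp ζ Y n) := by
  have h1 : Measurable[ℱ n] fun ω ↦ ∑ t ∈ Finset.range n, Y t ω ^ 2 / 2 :=
    Finset.measurable_fun_sum _ fun t ht ↦
      (((hY t).mono (ℱ.mono (Finset.mem_range.1 ht).le) le_rfl).pow_const 2).div_const 2
  have h2 := h.measurable_sum_mul hY n
  exact (Complex.measurable_exp.comp (Complex.measurable_ofReal.comp h1)).mul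
    (Complex.measurable_exp.comp ((Complex.measurable_ofReal.comp h2).mul_const _))

/-- Telescoping in `n`: integrating out `ζ k` given the past multiplies the compensated exponential
by `φ(Y k) exp(Y k ² / 2)`, so each increment of the mean is an integral of this factor minus `1`
against a variable of norm at most `exp(B / 2)`. The pathwise bound `B` is what makes the truncation
below necessary. -/
lemma norm_integral_compensatedExp_sub_one_le [IsProbabilityMeasure μ]
    (h : IsInnovation μ ℱ ζ) {Y : ℕ → Ω → ℝ}
    (hY : ∀ t, Measurable[ℱ t] (Y t)) {n : ℕ} {B : ℝ}
    (hB : ∀ ω, ∑ t ∈ Finset.range n, Y t ω ^ 2 ≤ B) :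
    ‖∫ ω, compensatedExp ζ Y n ω ∂μ - 1‖ ≤ Real.exp (B / 2) * ∑ t ∈ Finset.range n,
      ∫ ω, ‖charFun (μ.map (ζ 0)) (Y t ω) * Complex.exp ((Y t ω ^ 2 / 2 : ℝ)) - 1‖ ∂μ := by
  have hYm : ∀ t, Measurable (Y t) := fun t ↦ (hY t).mono (ℱ.le _) le_rfl
  have hpart : ∀ k ≤ n, ∀ ω, ∑ t ∈ Finset.range k, Y t ω ^ 2 ≤ B := fun k hk ω ↦
    (Finset.sum_le_sum_of_subset_of_nonneg (Finset.range_mono hk)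
      fun _ _ _ ↦ sq_nonneg _).trans (hB ω)
  have hnorm : ∀ k ≤ n, ∀ ω, ‖compensatedExp ζ Y k ω‖ ≤ Real.exp (B / 2) := fun k hk ω ↦ by
    rw [norm_compensatedExp, ← Finset.sum_div]
    exact Real.exp_le_exp.2 (by linarith [hpart k hk ω])
  have hZm : ∀ k, Measurable (compensatedExp ζ Y k) := fun k ↦
    (h.measurable_compensatedExp hY k).mono (ℱ.le _) le_rfl
  have hZi : ∀ k ≤ n, Integrable (compensatedExp ζ Y k) μ := fun k hk ↦
    Integrable.of_bound (hZm k).aestronglyMeasurable _ (ae_of_all _ (hnorm k hk))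
  have hφm : Measurable (charFun (μ.map (ζ 0))) := by
    have := Measure.isProbabilityMeasure_map (μ := μ) (h.measurable 0).aemeasurable
    fun_prop
  have hφ1 : ∀ x, ‖charFun (μ.map (ζ 0)) x‖ ≤ 1 := fun x ↦ by
    have := Measure.isProbabilityMeasure_map (μ := μ) (h.measurable 0).aemeasurable
    exact norm_charFun_le_one _
  set ψ : ℕ → Ω → ℂ := fun t ω ↦
    charFun (μ.map (ζ 0)) (Y t ω) * Complex.exp ((Y t ω ^ 2 / 2 : ℝ)) - 1 with hψ
  have hψm : ∀ t, Measurable (ψ t) := fun t ↦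
    ((hφm.comp (hYm t)).mul (Complex.measurable_exp.comp
      (Complex.measurable_ofReal.comp (((hYm t).pow_const 2).div_const 2)))).sub_const 1
  have hterm : ∀ t < n, ∀ ω, Y t ω ^ 2 ≤ B := fun t ht ω ↦
    (Finset.single_le_sum (f := fun t ↦ Y t ω ^ 2) (fun _ _ ↦ sq_nonneg _)
      (Finset.mem_range.2 ht)).trans (hB ω)
  have hψi : ∀ t < n, Integrable (ψ t) μ := fun t ht ↦ by
    refine Integrable.of_bound (hψm t).aestronglyMeasurable (Real.exp (B / 2) + 1)
      (ae_of_all _ fun ω ↦ (norm_sub_le _ _).trans (add_le_add ?_ (by simp)))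
    rw [norm_mul, Complex.norm_exp_ofReal]
    calc _ ≤ 1 * Real.exp (B / 2) := by
          gcongr
          · exact hφ1 _
          · exact hterm t ht ω
      _ = _ := one_mul _
  have hstep : ∀ k < n, ∫ ω, compensatedExp ζ Y (k + 1) ω ∂μ - ∫ ω, compensatedExp ζ Y k ω ∂μ
      = ∫ ω, compensatedExp ζ Y k ω * ψ k ω ∂μ := by
    intro k hk
    set g : Ω → ℂ := fun ω ↦ compensatedExp ζ Y k ω * Complex.exp ((Y k ω ^ 2 / 2 : ℝ)) with hg
    have hgm : Measurable[ℱ k] g := (h.measurable_compensatedExp hY k).mul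
      (Complex.measurable_exp.comp
        (Complex.measurable_ofReal.comp (((hY k).pow_const 2).div_const 2)))
    have hgi : Integrable g μ := by
      refine Integrable.of_bound (hgm.mono (ℱ.le _) le_rfl).aestronglyMeasurable
        (Real.exp (B / 2) * Real.exp (B / 2)) (ae_of_all _ fun ω ↦ ?_)
      rw [hg, norm_mul, Complex.norm_exp_ofReal]
      gcongr
      · exact hnorm k hk.le ω
      · exact hterm k hk ω
    -- `g` and `Y k` are jointly known at time `k`, so `ζ k` can be integrated out with both held
    -- fixed.
    have hind := h.indepFun (Y := fun ω ↦ (g ω, Y k ω)) (hgm.prodMk (hY k))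
    have hsucc : ∀ ω, compensatedExp ζ Y (k + 1) ω
        = g ω * Complex.exp ((Y k ω * ζ k ω : ℝ) * Complex.I) := fun ω ↦ by
      simp only [hg, compensatedExp, Finset.sum_range_succ, Complex.ofReal_add, add_mul,
        Complex.exp_add]
      ring
    simp_rw [hsucc]
    rw [hind.integral_mul_cexp_eq (hgm.mono (ℱ.le _) le_rfl) (hYm k) (h.measurable k) hgi,
      (h.identDistrib k).map_eq, ← integral_sub _ (hZi k hk.le)]
    · congr 1 with ω
      simp only [hg, hψ]
      ring
    · exact hgi.mul_bdd (hφm.comp (hYm k)).aestronglyMeasurable (ae_of_all _ fun ω ↦ hφ1 _)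
  have htel : ∫ ω, compensatedExp ζ Y n ω ∂μ - 1
      = ∑ t ∈ Finset.range n, ∫ ω, compensatedExp ζ Y t ω * ψ t ω ∂μ := by
    rw [← Finset.sum_congr rfl fun t ht ↦ hstep t (Finset.mem_range.1 ht),
      Finset.sum_range_sub (fun k ↦ ∫ ω, compensatedExp ζ Y k ω ∂μ)]
    simp [compensatedExp]
  rw [htel, Finset.mul_sum]
  refine (norm_sum_le _ _).trans (Finset.sum_le_sum fun t ht ↦ ?_)
  have ht' := Finset.mem_range.1 ht
  rw [← integral_const_mul]
  refine norm_integral_le_of_norm_le ((hψi t ht').norm.const_mul _) (ae_of_all _ fun ω ↦ ?_)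
  rw [norm_mul]
  exact mul_le_mul_of_nonneg_right (hnorm t ht'.le ω) (norm_nonneg _)

end IsInnovation

/-! ### Stopping at a bounded quadratic characteristic -/

section Truncation

variable {Ω : Type*}

/-- The process `Y` stopped before its quadratic characteristic exceeds `2`. -/
def truncAtTwo (Y : ℕ → Ω → ℝ) (t : ℕ) (ω : Ω) : ℝ :=
  if ∑ s ∈ Finset.range (t + 1), Y s ω ^ 2 ≤ 2 then Y t ω else 0

/-- The stopping rule inspects the squares only up to index `t`, each already known at time `t`, so
predictability survives. -/
lemma measurable_truncAtTwo {mΩ : MeasurableSpace Ω} {ℱ : Filtration ℕ mΩ} {Y : ℕ → Ω → ℝ}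
    (hY : ∀ t, Measurable[ℱ t] (Y t)) (t : ℕ) : Measurable[ℱ t] (truncAtTwo Y t) := by
  refine Measurable.ite (measurableSet_le ?_ measurable_const) (hY t) measurable_const
  exact Finset.measurable_fun_sum _ fun s hs ↦
    ((hY s).mono (ℱ.mono (by simp at hs; omega)) le_rfl).pow_const 2

lemma abs_truncAtTwo_le (Y : ℕ → Ω → ℝ) (t : ℕ) (ω : Ω) : |truncAtTwo Y t ω| ≤ |Y t ω| := by
  unfold truncAtTwo; split_ifs <;> simp

lemma sum_sq_truncAtTwo_le (Y : ℕ → Ω → ℝ) (n : ℕ) (ω : Ω) :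
    ∑ t ∈ Finset.range n, truncAtTwo Y t ω ^ 2 ≤ 2 := by
  -- The comparison with the untruncated sum is carried along in the induction: at a retained index
  -- it bounds the new truncated sum by a sum that is at most `2`.
  suffices ∑ t ∈ Finset.range n, truncAtTwo Y t ω ^ 2 ≤ 2 ∧
      ∑ t ∈ Finset.range n, truncAtTwo Y t ω ^ 2 ≤ ∑ t ∈ Finset.range n, Y t ω ^ 2 from this.1
  induction n with
  | zero => simp
  | succ n ih =>
    rw [Finset.sum_range_succ, Finset.sum_range_succ]
    by_cases hc : ∑ s ∈ Finset.range (n + 1), Y s ω ^ 2 ≤ 2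
    · rw [truncAtTwo, if_pos hc]
      rw [Finset.sum_range_succ] at hc
      constructor <;> linarith [ih.2]
    · rw [truncAtTwo, if_neg hc]
      constructor <;> nlinarith [ih.1, ih.2, sq_nonneg (Y n ω)]

lemma truncAtTwo_eq {Y : ℕ → Ω → ℝ} {n : ℕ} {ω : Ω}
    (h : ∑ t ∈ Finset.range n, Y t ω ^ 2 ≤ 2) {t : ℕ} (ht : t < n) :
    truncAtTwo Y t ω = Y t ω :=
  if_pos <| (Finset.sum_le_sum_of_subset_of_nonneg (Finset.range_mono ht)
    fun _ _ _ ↦ sq_nonneg _).trans h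

end Truncation

/-! ### The martingale central limit theorem -/

namespace IsInnovation

variable {Ω : Type*} {mΩ : MeasurableSpace Ω} {μ : Measure Ω} {ℱ : Filtration ℕ mΩ}
  {ζ : ℕ → Ω → ℝ} [IsProbabilityMeasure μ]

/-- The deviation from `1` is at most `δ` times the total variance, bounded by `C`, plus a constant
times a Lindeberg sum; `n → ∞` removes the latter for fixed `δ`. Truncation only decreases `|Y|`, so
both are estimated with the original `Y`. -/
lemma tendsto_integral_compensatedExp (h : IsInnovation μ ℱ ζ)
    (h0 : ∫ ω, ζ 0 ω ∂μ = 0) (h1 : ∫ ω, ζ 0 ω ^ 2 ∂μ = 1) {Y : ℕ → ℕ → Ω → ℝ}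
    (hY : ∀ n t, Measurable[ℱ t] (Y n t)) (hY2 : ∀ n t, MemLp (Y n t) 2 μ) {C : ℝ}
    (hC : ∀ᶠ n in atTop, ∑ t ∈ Finset.range n, ∫ ω, Y n t ω ^ 2 ∂μ ≤ C)
    (hL : ∀ η > 0, Tendsto (fun n ↦ ∑ t ∈ Finset.range n,
      ∫ ω in {ω | η < |Y n t ω|}, Y n t ω ^ 2 ∂μ) atTop (𝓝 0)) (u : ℝ) :
    Tendsto (fun n ↦ ∫ ω, compensatedExp ζ (fun t ω ↦ u * truncAtTwo (Y n) t ω) n ω ∂μ)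
      atTop (𝓝 1) := by
  have hC0 : 0 ≤ C := by
    obtain ⟨n, hn⟩ := hC.exists
    exact (Finset.sum_nonneg fun t _ ↦ integral_nonneg fun ω ↦ sq_nonneg _).trans hn
  have hYm : ∀ n t, Measurable (Y n t) := fun n t ↦ (hY n t).mono (ℱ.le _) le_rfl
  have htm : ∀ n t, Measurable (truncAtTwo (Y n) t) := fun n t ↦
    (measurable_truncAtTwo (hY n) t).mono (ℱ.le _) le_rfl
  have hB : ∀ n ω, ∑ t ∈ Finset.range n, (u * truncAtTwo (Y n) t ω) ^ 2 ≤ u ^ 2 * 2 := by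
    intro n ω
    simp_rw [mul_pow]
    rw [← Finset.mul_sum]
    exact mul_le_mul_of_nonneg_left (sum_sq_truncAtTwo_le _ _ _) (sq_nonneg _)
  have hbound : ∀ δ > 0, ∃ η > 0, ∃ K ≥ 0, ∀ n,
      ‖∫ ω, compensatedExp ζ (fun t ω ↦ u * truncAtTwo (Y n) t ω) n ω ∂μ - 1‖
        ≤ δ * ∑ t ∈ Finset.range n, ∫ ω, Y n t ω ^ 2 ∂μ
          + K * ∑ t ∈ Finset.range n, ∫ ω in {ω | η < |Y n t ω|}, Y n t ω ^ 2 ∂μ := by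
    intro δ hδ
    -- `D` dominates the factor `exp(u²) * u²` that multiplies `δ`; the added `1` keeps it positive
    -- when `u = 0`, as does `|u| + 1` in the threshold below.
    set D := Real.exp (u ^ 2 * 2 / 2) * (u ^ 2 + 1) with hD
    have hDpos : 0 < D := by positivity
    obtain ⟨η, hη, K, hK, hφ⟩ := exists_norm_charFun_mul_exp_sub_one_le
      (h.measurable 0).aemeasurable h0 h1 (u ^ 2 * 2) (δ := δ / D) (by positivity)
    have hv : 0 < |u| + 1 := by positivity
    refine ⟨η / (|u| + 1), by positivity, Real.exp (u ^ 2 * 2 / 2) * (K * u ^ 2), by positivity,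
      fun n ↦ ?_⟩
    refine (h.norm_integral_compensatedExp_sub_one_le
      (fun t ↦ (measurable_truncAtTwo (hY n) t).const_mul u) (hB n)).trans ?_
    rw [Finset.mul_sum, Finset.mul_sum, Finset.mul_sum, ← Finset.sum_add_distrib]
    refine Finset.sum_le_sum fun t ht ↦ ?_
    have hset : MeasurableSet {ω | η / (|u| + 1) < |Y n t ω|} :=
      measurableSet_lt measurable_const (hYm n t).abs
    have hsq := (hY2 n t).integrable_sq
    have hle : ∀ ω, ‖charFun (μ.map (ζ 0)) (u * truncAtTwo (Y n) t ω) *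
        Complex.exp (((u * truncAtTwo (Y n) t ω) ^ 2 / 2 : ℝ)) - 1‖
        ≤ δ / D * u ^ 2 * Y n t ω ^ 2 + K * u ^ 2 *
          ({ω | η / (|u| + 1) < |Y n t ω|}.indicator (fun ω ↦ Y n t ω ^ 2) ω) := by
      intro ω
      have hab := abs_truncAtTwo_le (Y n) t ω
      have hsq' : truncAtTwo (Y n) t ω ^ 2 ≤ Y n t ω ^ 2 := sq_le_sq.2 hab
      refine (hφ (u * truncAtTwo (Y n) t ω) ((Finset.single_le_sum
        (f := fun t ↦ (u * truncAtTwo (Y n) t ω) ^ 2) (fun _ _ ↦ sq_nonneg _) ht).trans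
          (hB n ω))).trans (add_le_add ?_ ?_)
      · rw [mul_pow, ← mul_assoc]
        gcongr
      · rw [mul_assoc]
        refine mul_le_mul_of_nonneg_left ?_ hK
        split_ifs with hlt
        · have : ω ∈ {ω | η / (|u| + 1) < |Y n t ω|} := by
            rw [Set.mem_ofPred_eq, div_lt_iff₀ hv]
            rw [abs_mul] at hlt
            nlinarith [abs_nonneg u, abs_nonneg (Y n t ω)]
          rw [Set.indicator_of_mem this, mul_pow]
          gcongr
        · exact mul_nonneg (sq_nonneg _) (Set.indicator_nonneg (fun _ _ ↦ sq_nonneg _) _)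
    have hint : ∫ ω, ‖charFun (μ.map (ζ 0)) (u * truncAtTwo (Y n) t ω) *
        Complex.exp (((u * truncAtTwo (Y n) t ω) ^ 2 / 2 : ℝ)) - 1‖ ∂μ
        ≤ δ / D * u ^ 2 * ∫ ω, Y n t ω ^ 2 ∂μ
          + K * u ^ 2 * ∫ ω in {ω | η / (|u| + 1) < |Y n t ω|}, Y n t ω ^ 2 ∂μ := by
      rw [← integral_indicator hset, ← integral_const_mul, ← integral_const_mul, ← integral_add
        (hsq.const_mul _) ((hsq.indicator hset).const_mul _)]
      exact integral_mono_of_nonneg (ae_of_all _ fun _ ↦ norm_nonneg _)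
        ((hsq.const_mul _).add ((hsq.indicator hset).const_mul _)) (ae_of_all _ hle)
    have hI : 0 ≤ ∫ ω, Y n t ω ^ 2 ∂μ := integral_nonneg fun ω ↦ sq_nonneg _
    calc _ ≤ Real.exp (u ^ 2 * 2 / 2) * _ := mul_le_mul_of_nonneg_left hint (Real.exp_nonneg _)
      _ = Real.exp (u ^ 2 * 2 / 2) * u ^ 2 * (δ / D) * ∫ ω, Y n t ω ^ 2 ∂μ
          + Real.exp (u ^ 2 * 2 / 2) * (K * u ^ 2) *
            ∫ ω in {ω | η / (|u| + 1) < |Y n t ω|}, Y n t ω ^ 2 ∂μ := by ring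
      _ ≤ _ := by
        gcongr
        calc Real.exp (u ^ 2 * 2 / 2) * u ^ 2 * (δ / D) ≤ D * (δ / D) := by
              rw [hD]; gcongr; linarith
          _ = δ := by field_simp
  rw [Metric.tendsto_nhds]
  intro e he
  obtain ⟨η, hη, K, hK, hb⟩ := hbound (e / (2 * (C + 1))) (by positivity)
  have hlim : Tendsto (fun n ↦ K * ∑ t ∈ Finset.range n,
      ∫ ω in {ω | η < |Y n t ω|}, Y n t ω ^ 2 ∂μ) atTop (𝓝 0) := by
    simpa using (hL η hη).const_mul K
  filter_upwards [hC, hlim.eventually_lt_const (half_pos he)] with n hn1 hn2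
  rw [dist_eq_norm]
  refine (hb n).trans_lt ?_
  have : e / (2 * (C + 1)) * ∑ t ∈ Finset.range n, ∫ ω, Y n t ω ^ 2 ∂μ ≤ e / 2 := by
    calc _ ≤ e / (2 * (C + 1)) * (C + 1) := by gcongr; linarith
      _ = e / 2 := by field_simp
  linarith

/-- A **martingale central limit theorem** for martingale transforms `∑ Y n t * ζ t` of i.i.d.
innovations under a Lindeberg condition. -/
theorem tendstoInDistribution_sum_mul (h : IsInnovation μ ℱ ζ)
    (h0 : ∫ ω, ζ 0 ω ∂μ = 0) (h1 : ∫ ω, ζ 0 ω ^ 2 ∂μ = 1) {Y : ℕ → ℕ → Ω → ℝ}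
    (hY : ∀ n t, Measurable[ℱ t] (Y n t)) (hY2 : ∀ n t, MemLp (Y n t) 2 μ) {C : ℝ}
    (hC : ∀ᶠ n in atTop, ∑ t ∈ Finset.range n, ∫ ω, Y n t ω ^ 2 ∂μ ≤ C)
    (hL : ∀ η > 0, Tendsto (fun n ↦ ∑ t ∈ Finset.range n,
      ∫ ω in {ω | η < |Y n t ω|}, Y n t ω ^ 2 ∂μ) atTop (𝓝 0))
    (hV : TendstoInMeasure μ (fun n ω ↦ ∑ t ∈ Finset.range n, Y n t ω ^ 2) atTop (fun _ ↦ 1)) :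
    TendstoInDistribution (fun n ω ↦ ∑ t ∈ Finset.range n, Y n t ω * ζ t ω) atTop (id : ℝ → ℝ)
      (fun _ ↦ μ) (gaussianReal 0 1) := by
  have hYm : ∀ n t, Measurable (Y n t) := fun n t ↦ (hY n t).mono (ℱ.le _) le_rfl
  have hSm : ∀ n, Measurable fun ω ↦ ∑ t ∈ Finset.range n, Y n t ω * ζ t ω := fun n ↦
    (h.measurable_sum_mul (hY n) n).mono (ℱ.le _) le_rfl
  refine ⟨fun n ↦ (hSm n).aemeasurable, aemeasurable_id, ?_⟩
  refine ProbabilityMeasure.tendsto_iff_tendsto_charFun.2 fun u ↦ ?_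
  simp only [ProbabilityMeasure.coe_mk, Measure.map_id]
  have hcf : ∀ n, charFun (μ.map fun ω ↦ ∑ t ∈ Finset.range n, Y n t ω * ζ t ω) u
      = ∫ ω, Complex.exp (((u * ∑ t ∈ Finset.range n, Y n t ω * ζ t ω : ℝ)) * Complex.I) ∂μ := by
    intro n
    rw [charFun_apply_real, integral_map (hSm n).aemeasurable (by fun_prop)]
    simp
  have hgauss : charFun (gaussianReal 0 1) u = (Real.exp (-(u ^ 2 / 2)) : ℂ) := by
    rw [charFun_gaussianReal]; push_cast; congr 1; simp
  simp_rw [hcf, hgauss]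
  set Z : ℕ → Ω → ℂ := fun n ↦ compensatedExp ζ (fun t ω ↦ u * truncAtTwo (Y n) t ω) n with hZ
  have hZlim := h.tendsto_integral_compensatedExp h0 h1 hY hY2 hC hL u
  have hZm : ∀ n, Measurable (Z n) := fun n ↦ (h.measurable_compensatedExp
    (fun t ↦ (measurable_truncAtTwo (hY n) t).const_mul u) n).mono (ℱ.le _) le_rfl
  have hZn : ∀ n ω, ‖Z n ω‖ ≤ Real.exp (u ^ 2) := by
    intro n ω
    rw [norm_compensatedExp]
    refine Real.exp_le_exp.2 ?_
    simp_rw [mul_pow, mul_div_assoc]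
    rw [← Finset.mul_sum, ← Finset.sum_div]
    have := sum_sq_truncAtTwo_le (Y n) n ω
    nlinarith [sq_nonneg u]
  have hZi : ∀ n, Integrable (Z n) μ := fun n ↦
    Integrable.of_bound (hZm n).aestronglyMeasurable _ (ae_of_all _ (hZn n))
  have hEm : ∀ n, Measurable fun ω ↦
      Complex.exp (((u * ∑ t ∈ Finset.range n, Y n t ω * ζ t ω : ℝ)) * Complex.I) := fun n ↦
    Complex.measurable_exp.comp
      ((Complex.measurable_ofReal.comp ((hSm n).const_mul u)).mul_const _)
  have hEi : ∀ n, Integrable (fun ω ↦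
      Complex.exp (((u * ∑ t ∈ Finset.range n, Y n t ω * ζ t ω : ℝ)) * Complex.I)) μ := fun n ↦
    Integrable.of_bound (hEm n).aestronglyMeasurable 1 (ae_of_all _ fun ω ↦ by
      rw [Complex.norm_exp_ofReal_mul_I])
  set c : ℂ := (Real.exp (-(u ^ 2 / 2)) : ℂ) with hc
  -- Since `Z n` has mean tending to `1`, it remains to show that this difference has mean tending
  -- to `0`. It is uniformly bounded, and small where the quadratic characteristic is near `1`.
  set F : ℕ → Ω → ℂ := fun n ω ↦
    Complex.exp (((u * ∑ t ∈ Finset.range n, Y n t ω * ζ t ω : ℝ)) * Complex.I) - c * Z n ω with hF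
  have hcn : ‖c‖ ≤ 1 := by
    rw [hc, Complex.norm_real, Real.norm_of_nonneg (Real.exp_nonneg _)]
    exact Real.exp_le_one_iff.2 (by nlinarith [sq_nonneg u])
  have hFb : ∀ n ω, ‖F n ω‖ ≤ 1 + Real.exp (u ^ 2) := by
    intro n ω
    refine (norm_sub_le _ _).trans (add_le_add ?_ ?_)
    · rw [Complex.norm_exp_ofReal_mul_I]
    · rw [norm_mul]
      calc _ ≤ 1 * Real.exp (u ^ 2) := mul_le_mul hcn (hZn n ω) (norm_nonneg _) zero_le_one
        _ = _ := one_mul _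
  have hFm : ∀ n, Measurable (F n) := fun n ↦ (hEm n).sub ((hZm n).const_mul c)
  have hFi : ∀ n, Integrable (F n) μ := fun n ↦ (hEi n).sub ((hZi n).const_mul c)
  have hFeq : ∀ n ω, ∑ t ∈ Finset.range n, Y n t ω ^ 2 ≤ 2 → ‖F n ω‖
      = |Real.exp (u ^ 2 / 2 * (∑ t ∈ Finset.range n, Y n t ω ^ 2 - 1)) - 1| := by
    intro n ω hω
    have hZe : Z n ω = (Real.exp (u ^ 2 / 2 * ∑ t ∈ Finset.range n, Y n t ω ^ 2) : ℂ) *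
        Complex.exp (((u * ∑ t ∈ Finset.range n, Y n t ω * ζ t ω : ℝ)) * Complex.I) := by
      have e1 : ∑ t ∈ Finset.range n, (u * truncAtTwo (Y n) t ω) ^ 2 / 2
          = u ^ 2 / 2 * ∑ t ∈ Finset.range n, Y n t ω ^ 2 := by
        rw [Finset.mul_sum]
        refine Finset.sum_congr rfl fun t ht ↦ ?_
        rw [truncAtTwo_eq hω (Finset.mem_range.1 ht)]; ring
      have e2 : ∑ t ∈ Finset.range n, u * truncAtTwo (Y n) t ω * ζ t ω
          = u * ∑ t ∈ Finset.range n, Y n t ω * ζ t ω := by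
        rw [Finset.mul_sum]
        refine Finset.sum_congr rfl fun t ht ↦ ?_
        rw [truncAtTwo_eq hω (Finset.mem_range.1 ht)]; ring
      simp only [hZ, compensatedExp, e1, e2, Complex.ofReal_exp]
    have : F n ω = -(((Real.exp (u ^ 2 / 2 * (∑ t ∈ Finset.range n, Y n t ω ^ 2 - 1)) - 1 : ℝ)) : ℂ)
        * Complex.exp (((u * ∑ t ∈ Finset.range n, Y n t ω * ζ t ω : ℝ)) * Complex.I) := by
      simp only [hF, hZe, hc]
      rw [show u ^ 2 / 2 * (∑ t ∈ Finset.range n, Y n t ω ^ 2 - 1)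
        = -(u ^ 2 / 2) + u ^ 2 / 2 * ∑ t ∈ Finset.range n, Y n t ω ^ 2 by ring, Real.exp_add]
      push_cast
      ring
    rw [this, norm_mul, Complex.norm_exp_ofReal_mul_I, mul_one, norm_neg, Complex.norm_real,
      Real.norm_eq_abs]
  have hFlim : Tendsto (fun n ↦ ∫ ω, F n ω ∂μ) atTop (𝓝 0) := by
    rw [Metric.tendsto_nhds]
    intro e he
    have hcont : Tendsto (fun v : ℝ ↦ |Real.exp (u ^ 2 / 2 * (v - 1)) - 1|) (𝓝 1) (𝓝 0) := by
      have : Continuous fun v : ℝ ↦ |Real.exp (u ^ 2 / 2 * (v - 1)) - 1| := by fun_prop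
      simpa using this.tendsto 1
    obtain ⟨η, hη, hηb⟩ := Metric.eventually_nhds_iff.1
      (hcont.eventually_lt_const (half_pos he))
    -- The cap at `1` keeps the quadratic characteristic below `2` off the exceptional set `A`,
    -- where the truncation is therefore inactive.
    set η' := min η 1 with hη'
    have hη'0 : 0 < η' := lt_min hη one_pos
    rw [tendstoInMeasure_iff_measureReal_norm] at hV
    have hP := ((hV η' hη'0).const_mul (1 + Real.exp (u ^ 2)))
    rw [mul_zero] at hP
    filter_upwards [hP.eventually_lt_const (half_pos he)] with n hn
    rw [dist_zero_right]
    set A := {ω | η' ≤ ‖∑ t ∈ Finset.range n, Y n t ω ^ 2 - 1‖} with hA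
    have hAm : MeasurableSet A := measurableSet_le measurable_const
      ((Finset.measurable_fun_sum _ fun t _ ↦ (hYm n t).pow_const 2).sub_const 1).norm
    have hle : ∀ ω, ‖F n ω‖ ≤ e / 2 + A.indicator (fun _ ↦ 1 + Real.exp (u ^ 2)) ω := by
      intro ω
      by_cases hω : ω ∈ A
      · rw [Set.indicator_of_mem hω]
        linarith [hFb n ω]
      · rw [Set.indicator_of_notMem hω, add_zero]
        rw [hA, Set.mem_ofPred_eq, not_le, Real.norm_eq_abs] at hω
        have h1' : |∑ t ∈ Finset.range n, Y n t ω ^ 2 - 1| < 1 := hω.trans_le (min_le_right _ _)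
        rw [hFeq n ω (by linarith [(abs_lt.1 h1').2])]
        exact (hηb (by rw [Real.dist_eq]; exact hω.trans_le (min_le_left _ _))).le
    calc ‖∫ ω, F n ω ∂μ‖ ≤ ∫ ω, (e / 2 + A.indicator (fun _ ↦ 1 + Real.exp (u ^ 2)) ω) ∂μ :=
          norm_integral_le_of_norm_le
            ((integrable_const _).add ((integrable_const _).indicator hAm)) (ae_of_all _ hle)
      _ = e / 2 + (1 + Real.exp (u ^ 2)) * μ.real A := by
          rw [integral_add (integrable_const _) ((integrable_const _).indicator hAm),
            integral_indicator hAm]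
          simp [mul_comm]
      _ < e := by linarith
  have hdecomp : ∀ n, ∫ ω, Complex.exp
      (((u * ∑ t ∈ Finset.range n, Y n t ω * ζ t ω : ℝ)) * Complex.I) ∂μ
      = ∫ ω, F n ω ∂μ + c * ∫ ω, Z n ω ∂μ := by
    intro n
    rw [hF, integral_sub (hEi n) ((hZi n).const_mul c), integral_const_mul]
    ring
  simp_rw [hdecomp]
  simpa using hFlim.add (hZlim.const_mul c)

end IsInnovation

/-! ### Moments and the law of large numbers for the AR(1) process -/

/-- Weighted sums of the solution of a linear recursion. -/
lemma sum_mul_eq_of_linear_recursion {q : ℝ} {c p D : ℕ → ℝ}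
    (hD : ∀ t, D (t + 1) = q * D t + p t) (n : ℕ) :
    ∑ t ∈ Finset.Ico 1 n, c t * D t = D 0 * ∑ t ∈ Finset.Ico 1 n, c t * q ^ t
      + ∑ i ∈ Finset.range n, p i * ∑ t ∈ Finset.Ico (i + 1) n, c t * q ^ (t - 1 - i) := by
  have hclosed : ∀ t, D t = q ^ t * D 0 + ∑ i ∈ Finset.range t, q ^ (t - 1 - i) * p i := by
    intro t
    induction t with
    | zero => simp
    | succ t ih =>
      rw [hD, ih, Finset.sum_range_succ, mul_add, Finset.mul_sum]
      simp only [Nat.add_sub_cancel, Nat.sub_self, pow_zero, one_mul]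
      rw [pow_succ, ← add_assoc]
      congr 2
      · ring
      · refine Finset.sum_congr rfl fun i hi ↦ ?_
        rw [Finset.mem_range] at hi
        rw [← mul_assoc, ← pow_succ', show t - 1 - i + 1 = t - i by omega]
  calc ∑ t ∈ Finset.Ico 1 n, c t * D t
      = ∑ t ∈ Finset.Ico 1 n, D 0 * (c t * q ^ t) + ∑ t ∈ Finset.Ico 1 n,
          ∑ i ∈ Finset.range t, p i * (c t * q ^ (t - 1 - i)) := by
        rw [← Finset.sum_add_distrib]
        refine Finset.sum_congr rfl fun t _ ↦ ?_
        rw [hclosed t, mul_add, Finset.mul_sum]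
        congr 1
        · ring
        · exact Finset.sum_congr rfl fun i _ ↦ by ring
    _ = _ := by
        simp_rw [Finset.mul_sum]
        congr 1
        refine Finset.sum_comm' fun t i ↦ ?_
        simp only [Finset.mem_Ico, Finset.mem_range]
        omega

/-- An AR(1) process `X (t + 1) = θ * X t + σ t * ζ t` adapted to `ℱ`, driven by standardized
innovations, whose scales satisfy `σ i ≤ M * σ j` for `i ≤ j`. -/
structure IsAdaptedAR1 {Ω : Type*} {mΩ : MeasurableSpace Ω} (μ : Measure Ω)
    (ℱ : Filtration ℕ mΩ) (θ M : ℝ) (σ : ℕ → ℝ) (ζ X : ℕ → Ω → ℝ) : Prop where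
  abs_lt_one : |θ| < 1
  pos : ∀ t, 0 < σ t
  le_mul : ∀ i j, i ≤ j → σ i ≤ M * σ j
  innovation : IsInnovation μ ℱ ζ
  memLp_innovation : MemLp (ζ 0) 2 μ
  mean_innovation : ∫ ω, ζ 0 ω ∂μ = 0
  integral_sq_innovation : ∫ ω, ζ 0 ω ^ 2 ∂μ = 1
  measurable_adapted : ∀ t, Measurable[ℱ t] (X t)
  memLp_zero : MemLp (X 0) 2 μ
  succ : ∀ t ω, X (t + 1) ω = θ * X t ω + σ t * ζ t ω

/-- The total weight `∑_{i < t < n} θ^{2(t-1-i)} (σ_i / σ_t)²` of the squared innovation `i`. -/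
def arWeight (θ : ℝ) (σ : ℕ → ℝ) (n i : ℕ) : ℝ :=
  ∑ t ∈ Finset.Ico (i + 1) n, (θ ^ 2) ^ (t - 1 - i) * (σ i / σ t) ^ 2

/-- The total weight `∑_{1 ≤ t < n} θ^{2t} / σ_t²` of the squared initial value. -/
def arInitWeight (θ : ℝ) (σ : ℕ → ℝ) (n : ℕ) : ℝ :=
  ∑ t ∈ Finset.Ico 1 n, 1 / σ t ^ 2 * (θ ^ 2) ^ t

lemma arWeight_nonneg (θ : ℝ) (σ : ℕ → ℝ) (n i : ℕ) : 0 ≤ arWeight θ σ n i :=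
  Finset.sum_nonneg fun t _ ↦ by positivity

lemma arInitWeight_nonneg (θ : ℝ) (σ : ℕ → ℝ) (n : ℕ) : 0 ≤ arInitWeight θ σ n :=
  Finset.sum_nonneg fun t _ ↦ by positivity

/-- Used twice, with the same weights: for the second moments (`p = 1`) and pathwise for `X t ^ 2`.
Subtraction then isolates the fluctuations of `V`. -/
lemma sum_div_sq_eq_of_linear_recursion {θ : ℝ} {σ D p : ℕ → ℝ}
    (hD : ∀ t, D (t + 1) = θ ^ 2 * D t + σ t ^ 2 * p t) (n : ℕ) :
    ∑ t ∈ Finset.Ico 1 n, 1 / σ t ^ 2 * D t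
      = D 0 * arInitWeight θ σ n + ∑ i ∈ Finset.range n, arWeight θ σ n i * p i := by
  rw [sum_mul_eq_of_linear_recursion hD n, arInitWeight]
  congr 1
  refine Finset.sum_congr rfl fun i _ ↦ ?_
  rw [arWeight, Finset.mul_sum, Finset.sum_mul]
  refine Finset.sum_congr rfl fun t _ ↦ ?_
  rw [div_pow]
  ring

lemma sum_Ico_pow_le {q : ℝ} (h0 : 0 ≤ q) (h1 : q < 1) (k n : ℕ) :
    ∑ t ∈ Finset.Ico (k + 1) n, q ^ (t - 1 - k) ≤ (1 - q)⁻¹ := by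
  rw [Finset.sum_Ico_eq_sum_range]
  rw [← tsum_geometric_of_lt_one h0 h1]
  refine le_trans (le_of_eq (Finset.sum_congr rfl fun i _ ↦ ?_))
    ((summable_geometric_of_lt_one h0 h1).sum_le_tsum (Finset.range (n - (k + 1)))
      fun i _ ↦ pow_nonneg h0 i)
  congr 1; omega

namespace IsAdaptedAR1

variable {Ω : Type*} {mΩ : MeasurableSpace Ω} {μ : Measure Ω} {ℱ : Filtration ℕ mΩ}
  {θ M : ℝ} {σ : ℕ → ℝ} {ζ X : ℕ → Ω → ℝ}

section Deterministic

variable (h : IsAdaptedAR1 μ ℱ θ M σ ζ X)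
include h

lemma sq_lt_one : θ ^ 2 < 1 := by
  rw [← sq_abs]; exact pow_lt_one₀ (abs_nonneg _) h.abs_lt_one two_ne_zero

lemma ratio_sq_le {i j : ℕ} (hij : i ≤ j) : (σ i / σ j) ^ 2 ≤ M ^ 2 := by
  have := h.pos i
  have := h.pos j
  refine pow_le_pow_left₀ (by positivity) ?_ 2
  exact (div_le_iff₀ (h.pos j)).2 (h.le_mul i j hij)

lemma one_div_sq_le (t : ℕ) : 1 / σ t ^ 2 ≤ (M / σ 0) ^ 2 := by
  have h0 := h.pos 0
  have ht := h.pos t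
  have := h.ratio_sq_le (Nat.zero_le t)
  rw [div_pow, div_le_iff₀ (by positivity)] at this
  rw [div_pow, div_le_div_iff₀ (by positivity) (by positivity)]
  linarith

lemma arWeight_le (n i : ℕ) : arWeight θ σ n i ≤ M ^ 2 * (1 - θ ^ 2)⁻¹ := by
  calc arWeight θ σ n i ≤ ∑ t ∈ Finset.Ico (i + 1) n, M ^ 2 * (θ ^ 2) ^ (t - 1 - i) := by
        refine Finset.sum_le_sum fun t ht ↦ ?_
        rw [mul_comm (M ^ 2)]
        rw [Finset.mem_Ico] at ht
        exact mul_le_mul_of_nonneg_left (h.ratio_sq_le (by omega)) (by positivity)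
    _ ≤ _ := by
        rw [← Finset.mul_sum]
        exact mul_le_mul_of_nonneg_left (sum_Ico_pow_le (sq_nonneg θ) h.sq_lt_one i n) (sq_nonneg M)

lemma arInitWeight_le (n : ℕ) : arInitWeight θ σ n ≤ (M / σ 0) ^ 2 * (1 - θ ^ 2)⁻¹ := by
  calc arInitWeight θ σ n
      ≤ ∑ t ∈ Finset.Ico (0 + 1) n, (M / σ 0) ^ 2 * (θ ^ 2) ^ (t - 1 - 0) := by
        refine Finset.sum_le_sum fun t ht ↦ ?_
        refine mul_le_mul (h.one_div_sq_le t) ?_ (by positivity) (by positivity)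
        exact pow_le_pow_of_le_one (sq_nonneg _) h.sq_lt_one.le (by omega)
    _ ≤ _ := by
        rw [← Finset.mul_sum]
        exact mul_le_mul_of_nonneg_left (sum_Ico_pow_le (sq_nonneg θ) h.sq_lt_one 0 n) (sq_nonneg _)

end Deterministic

section Moments

variable (h : IsAdaptedAR1 μ ℱ θ M σ ζ X)
include h

lemma measurable (t : ℕ) : Measurable (X t) :=
  (h.measurable_adapted t).mono (ℱ.le _) le_rfl

lemma memLp (t : ℕ) : MemLp (X t) 2 μ := by
  induction t with
  | zero => exact h.memLp_zero
  | succ t ih =>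
    rw [show X (t + 1) = fun ω ↦ θ * X t ω + σ t * ζ t ω from funext (h.succ t)]
    exact (ih.const_mul θ).add ((h.innovation.memLp h.memLp_innovation t).const_mul (σ t))

/-- The cross term vanishes because `ζ t` is centered and independent of the past. The factor `1` is
kept to match the source term `p` of `sum_div_sq_eq_of_linear_recursion`. -/
lemma integral_sq_succ (t : ℕ) :
    ∫ ω, X (t + 1) ω ^ 2 ∂μ = θ ^ 2 * ∫ ω, X t ω ^ 2 ∂μ + σ t ^ 2 * 1 := by
  have hX := h.memLp t
  have hζ := h.innovation.memLp h.memLp_innovation t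
  have hc := hX.integrable_mul hζ
  have e : ∀ ω, X (t + 1) ω ^ 2
      = θ ^ 2 * X t ω ^ 2 + 2 * θ * σ t * (X t * ζ t) ω + σ t ^ 2 * ζ t ω ^ 2 := fun ω ↦ by
    rw [h.succ, Pi.mul_apply]; ring
  simp_rw [e]
  have h1 := hX.integrable_sq.const_mul (θ ^ 2)
  have h2 := hc.const_mul (2 * θ * σ t)
  have h3 := hζ.integrable_sq.const_mul (σ t ^ 2)
  have h12 : Integrable (fun ω ↦ θ ^ 2 * X t ω ^ 2 + 2 * θ * σ t * (X t * ζ t) ω) μ := h1.add h2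
  rw [integral_add h12 h3, integral_add h1 h2, integral_const_mul, integral_const_mul,
    integral_const_mul, h.innovation.integral_sq_eq, h.integral_sq_innovation]
  simp only [Pi.mul_apply]
  rw [h.innovation.integral_mul_eq_zero h.mean_innovation (h.measurable_adapted t)]
  ring

/-- The event `E` may depend on the whole path, so independence is unavailable; convexity of the
square, which holds pointwise, replaces it. -/
lemma setIntegral_sq_le {E : Set Ω} {c : ℝ}
    (hc : ∀ i, ∫ ω in E, ζ i ω ^ 2 ∂μ ≤ c) (t : ℕ) {m : ℝ} (hm : ∀ i < t, σ i ≤ m) :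
    ∫ ω in E, X t ω ^ 2 ∂μ ≤ ∫ ω in E, X 0 ω ^ 2 ∂μ + m ^ 2 * (c / (1 - |θ|) ^ 2) := by
  have hr := abs_nonneg θ
  have hr1 : 0 < 1 - |θ| := sub_pos.2 h.abs_lt_one
  have hc0 : 0 ≤ c := (integral_nonneg fun ω ↦ sq_nonneg _).trans (hc 0)
  have hI0 : 0 ≤ ∫ ω in E, X 0 ω ^ 2 ∂μ := integral_nonneg fun ω ↦ sq_nonneg _
  induction t with
  | zero => exact le_add_of_nonneg_right (by positivity)
  | succ t ih =>
    have ih' := ih fun i hi ↦ hm i (by omega)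
    have hσ := hm t (by omega)
    have hX := (h.memLp t).integrable_sq
    have hζ := (h.innovation.memLp h.memLp_innovation t).integrable_sq
    -- Convexity with weights `|θ|` and `1 - |θ|`. The defect is an explicit square divided by `|θ|
    -- * (1 - |θ|)`, hence the separate case `θ = 0`.
    have hconv : ∀ ω, X (t + 1) ω ^ 2
        ≤ |θ| * X t ω ^ 2 + σ t ^ 2 / (1 - |θ|) * ζ t ω ^ 2 := by
      intro ω
      rw [h.succ]
      have hdiff : |θ| * X t ω ^ 2 + σ t ^ 2 / (1 - |θ|) * ζ t ω ^ 2
          - (θ * X t ω + σ t * ζ t ω) ^ 2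
          = ((1 - |θ|) * θ * X t ω - |θ| * (σ t * ζ t ω)) ^ 2 / (|θ| * (1 - |θ|)) ∨ θ = 0 := by
        by_cases hθ : θ = 0
        · exact Or.inr hθ
        · left
          have hθ' : |θ| ≠ 0 := abs_ne_zero.2 hθ
          field_simp
          have : θ ^ 2 = |θ| ^ 2 := (sq_abs θ).symm
          ring_nf
          simp only [this]
          ring
      rcases hdiff with hd | hθ
      · have : 0 ≤ ((1 - |θ|) * θ * X t ω - |θ| * (σ t * ζ t ω)) ^ 2 / (|θ| * (1 - |θ|)) := by
          positivity
        linarith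
      · simp [hθ, mul_pow]
    calc ∫ ω in E, X (t + 1) ω ^ 2 ∂μ
        ≤ ∫ ω in E, (|θ| * X t ω ^ 2 + σ t ^ 2 / (1 - |θ|) * ζ t ω ^ 2) ∂μ :=
          integral_mono (h.memLp (t + 1)).integrable_sq.integrableOn
            (Integrable.integrableOn ((hX.const_mul _).add (hζ.const_mul _))) hconv
      _ = |θ| * ∫ ω in E, X t ω ^ 2 ∂μ + σ t ^ 2 / (1 - |θ|) * ∫ ω in E, ζ t ω ^ 2 ∂μ := by
          rw [integral_add (hX.const_mul _).integrableOn (hζ.const_mul _).integrableOn,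
            integral_const_mul, integral_const_mul]
      _ ≤ |θ| * (∫ ω in E, X 0 ω ^ 2 ∂μ + m ^ 2 * (c / (1 - |θ|) ^ 2))
          + m ^ 2 / (1 - |θ|) * c := by
          have := h.pos t
          gcongr
          exact hc t
      _ = |θ| * ∫ ω in E, X 0 ω ^ 2 ∂μ + m ^ 2 * (c / (1 - |θ|) ^ 2) := by
          field_simp
          ring
      _ ≤ _ := by
          gcongr
          exact mul_le_of_le_one_left hI0 h.abs_lt_one.le

lemma setIntegral_div_sq_le {E : Set Ω} {c : ℝ}
    (hc : ∀ i, ∫ ω in E, ζ i ω ^ 2 ∂μ ≤ c) (t : ℕ) :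
    ∫ ω in E, (X t ω / σ t) ^ 2 ∂μ
      ≤ (M / σ 0) ^ 2 * ∫ ω in E, X 0 ω ^ 2 ∂μ + M ^ 2 / (1 - |θ|) ^ 2 * c := by
  have ht := h.pos t
  have hI0 : 0 ≤ ∫ ω in E, X 0 ω ^ 2 ∂μ := integral_nonneg fun ω ↦ sq_nonneg _
  have h1 := h.setIntegral_sq_le hc t (m := M * σ t) fun i hi ↦ h.le_mul i t hi.le
  calc ∫ ω in E, (X t ω / σ t) ^ 2 ∂μ = 1 / σ t ^ 2 * ∫ ω in E, X t ω ^ 2 ∂μ := by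
        rw [← integral_const_mul]; congr 1 with ω; rw [div_pow]; ring
    _ ≤ 1 / σ t ^ 2 * (∫ ω in E, X 0 ω ^ 2 ∂μ + (M * σ t) ^ 2 * (c / (1 - |θ|) ^ 2)) := by
        gcongr
    _ = 1 / σ t ^ 2 * ∫ ω in E, X 0 ω ^ 2 ∂μ + M ^ 2 / (1 - |θ|) ^ 2 * c := by
        field_simp
    _ ≤ _ := by
        gcongr
        exact h.one_div_sq_le t

lemma exists_integral_div_sq_le : ∃ C, 0 ≤ C ∧ ∀ t, ∫ ω, (X t ω / σ t) ^ 2 ∂μ ≤ C := by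
  have hr1 : 0 < 1 - |θ| := sub_pos.2 h.abs_lt_one
  have hI0 : 0 ≤ ∫ ω, X 0 ω ^ 2 ∂μ := integral_nonneg fun ω ↦ sq_nonneg _
  refine ⟨(M / σ 0) ^ 2 * ∫ ω, X 0 ω ^ 2 ∂μ + M ^ 2 / (1 - |θ|) ^ 2 * 1, by positivity,
    fun t ↦ ?_⟩
  have := h.setIntegral_div_sq_le (E := Set.univ) (c := 1) (fun i ↦ by
    rw [setIntegral_univ, h.innovation.integral_sq_eq, h.integral_sq_innovation]) t
  simpa only [setIntegral_univ] using this

lemma memLp_div (t : ℕ) : MemLp (fun ω ↦ X t ω / σ t) 2 μ := by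
  simpa only [div_eq_inv_mul] using (h.memLp t).const_mul (σ t)⁻¹

/-- Uniform integrability of the squares of the standardized process. -/
lemma exists_setIntegral_div_sq_le [IsProbabilityMeasure μ] {δ : ℝ} (hδ : 0 < δ) :
    ∃ A > 0, ∀ B ≥ A, ∀ t, ∫ ω in {ω | B < |X t ω / σ t|}, (X t ω / σ t) ^ 2 ∂μ ≤ δ := by
  have hr1 : 0 < 1 - |θ| := sub_pos.2 h.abs_lt_one
  obtain ⟨C, hC0, hC⟩ := h.exists_integral_div_sq_le
  -- `L` dominates the sum of the two coefficients in `setIntegral_div_sq_le`, the added `1` making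
  -- it positive. Half of `δ` pays for the approximation errors `δ / (2 * L)`; `A` is chosen so that
  -- Chebyshev's bound `μ(E) ≤ C / A²` fits the rest into the other half.
  set L := (M / σ 0) ^ 2 + M ^ 2 / (1 - |θ|) ^ 2 + 1 with hL
  have hLpos : 0 < L := by positivity
  obtain ⟨K, hK, hKb⟩ := h.memLp_innovation.integrable_sq.exists_forall_setIntegral_abs_le
    (δ := δ / (2 * L)) (by positivity)
  obtain ⟨K', hK', hKb'⟩ := h.memLp_zero.integrable_sq.exists_forall_setIntegral_abs_le
    (δ := δ / (2 * L)) (by positivity)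
  set A := √(2 * L * (K + K') * C / δ) + 1 with hA
  have hA0 : 0 < A := by positivity
  have hA2 : 2 * L * (K + K') * C / δ ≤ A ^ 2 := by
    calc _ = √(2 * L * (K + K') * C / δ) ^ 2 := (Real.sq_sqrt (by positivity)).symm
      _ ≤ _ := pow_le_pow_left₀ (Real.sqrt_nonneg _) (by linarith) 2
  refine ⟨A, hA0, fun B hB t ↦ ?_⟩
  set E := {ω | B < |X t ω / σ t|} with hE
  have hB0 : 0 < B := hA0.trans_le hB
  have hEm : MeasurableSet E :=
    measurableSet_lt measurable_const ((h.measurable t).div_const _).abs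
  have hYi := (h.memLp_div t).integrable_sq
  have hPE : μ.real E * A ^ 2 ≤ C := by
    calc μ.real E * A ^ 2 ≤ μ.real E * B ^ 2 := by gcongr
      _ = ∫ ω in E, B ^ 2 ∂μ := by simp
      _ ≤ ∫ ω in E, (X t ω / σ t) ^ 2 ∂μ := by
          refine setIntegral_mono_on (integrable_const _).integrableOn hYi.integrableOn hEm
            fun ω hω ↦ ?_
          exact sq_le_sq.2 (by rw [abs_of_pos hB0]; exact le_of_lt hω)
      _ ≤ ∫ ω, (X t ω / σ t) ^ 2 ∂μ :=
          setIntegral_le_integral hYi (ae_of_all _ fun ω ↦ sq_nonneg _)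
      _ ≤ C := hC t
  have hKE : L * (K + K') * μ.real E ≤ δ / 2 := by
    rw [div_le_iff₀ hδ] at hA2
    have hA2pos : 0 < A ^ 2 := by positivity
    have hLK : 0 ≤ L * (K + K') := by positivity
    have : L * (K + K') * (μ.real E * A ^ 2) ≤ L * (K + K') * C :=
      mul_le_mul_of_nonneg_left hPE hLK
    refine le_of_mul_le_mul_right ?_ hA2pos
    nlinarith
  have hPE0 : 0 ≤ μ.real E := measureReal_nonneg
  set c := δ / (2 * L) + (K + K') * μ.real E with hc
  have h1 : ∀ i, ∫ ω in E, ζ i ω ^ 2 ∂μ ≤ c := by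
    intro i
    have := hKb (fun ω ↦ ζ i ω ^ 2)
      ((h.innovation.identDistrib i).comp (measurable_id.pow_const 2)) E hEm
    simp only [abs_sq] at this
    nlinarith
  have h2 : ∫ ω in E, X 0 ω ^ 2 ∂μ ≤ c := by
    have hmX := (h.measurable 0).pow_const 2
    have := hKb' (fun ω ↦ X 0 ω ^ 2) (IdentDistrib.refl hmX.aemeasurable) E hEm
    simp only [abs_sq] at this
    nlinarith
  have hc0 : 0 ≤ c := by positivity
  calc _ ≤ (M / σ 0) ^ 2 * ∫ ω in E, X 0 ω ^ 2 ∂μ + M ^ 2 / (1 - |θ|) ^ 2 * c :=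
        h.setIntegral_div_sq_le h1 t
    _ ≤ (M / σ 0) ^ 2 * c + M ^ 2 / (1 - |θ|) ^ 2 * c := by gcongr
    _ ≤ L * c := by rw [hL]; nlinarith
    _ = δ / 2 + L * (K + K') * μ.real E := by rw [hc]; field_simp
    _ ≤ δ := by linarith

lemma sum_integral_div_sq_eq (n : ℕ) :
    ∑ t ∈ Finset.Ico 1 n, 1 / σ t ^ 2 * ∫ ω, X t ω ^ 2 ∂μ
      = (∫ ω, X 0 ω ^ 2 ∂μ) * arInitWeight θ σ n + ∑ i ∈ Finset.range n, arWeight θ σ n i := by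
  rw [sum_div_sq_eq_of_linear_recursion h.integral_sq_succ n]
  simp

/-- The law of large numbers for the squares of the standardized process. -/
lemma tendsto_integral_abs_sum_sub_div [IsProbabilityMeasure μ] :
    Tendsto (fun n : ℕ ↦ (∫ ω, |∑ t ∈ Finset.Ico 1 n, (X t ω / σ t) ^ 2
      - ∑ t ∈ Finset.Ico 1 n, 1 / σ t ^ 2 * ∫ ω, X t ω ^ 2 ∂μ| ∂μ) / n) atTop (𝓝 0) := by
  obtain ⟨C, hC0, hC⟩ := h.exists_integral_div_sq_le
  set W := M ^ 2 * (1 - θ ^ 2)⁻¹ with hW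
  set I := (M / σ 0) ^ 2 * (1 - θ ^ 2)⁻¹ with hI
  set S : ℕ → Ω → ℝ := fun n ω ↦ ∑ i ∈ Finset.range n, arWeight θ σ n i * (ζ i ω ^ 2 - 1) with hS
  have hsq : IsInnovation μ ℱ (fun t ω ↦ ζ t ω ^ 2 - 1) :=
    h.innovation.comp (g := fun x ↦ x ^ 2 - 1) (by fun_prop)
  have hsqi : ∀ t, Integrable (fun ω ↦ ζ t ω ^ 2 - 1) μ := fun t ↦
    (h.innovation.memLp h.memLp_innovation t).integrable_sq.sub (integrable_const _)
  have hsq0 : ∫ ω, (ζ 0 ω ^ 2 - 1) ∂μ = 0 := by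
    rw [integral_sub h.memLp_innovation.integrable_sq (integrable_const _),
      h.integral_sq_innovation]
    simp
  have hSlim := hsq.tendsto_integral_abs_weighted_sum_div (hsqi 0) hsq0
    (a := arWeight θ σ) (C := W) fun n t ↦ by
      rw [abs_of_nonneg (arWeight_nonneg θ σ n t)]; exact h.arWeight_le n t
  have hSi : ∀ n, Integrable (S n) μ := fun n ↦
    integrable_finsetSum _ fun t _ ↦ (hsqi t).const_mul _
  set a : ℕ → ℕ → Ω → ℝ := fun n i ω ↦ arWeight θ σ n i * (2 * θ) * (X i ω / σ i) with ha
  have ham : ∀ n i, Measurable[ℱ i] (a n i) := fun n i ↦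
    ((h.measurable_adapted i).div_const _).const_mul _
  have haL : ∀ n i, MemLp (a n i) 2 μ := fun n i ↦ (h.memLp_div i).const_mul _
  set T : ℕ → Ω → ℝ := fun n ω ↦ ∑ i ∈ Finset.range n, a n i ω * ζ i ω with hT
  have hTL : ∀ n, MemLp (T n) 2 μ := fun n ↦
    h.innovation.memLp_sum_mul h.memLp_innovation (ham n) (haL n) n
  -- Orthogonality makes the second moment of `T n` of order `n`, so its mean absolute value is of
  -- order `√n`.
  have hTb : ∀ n : ℕ, ∫ ω, |T n ω| ∂μ ≤ √(n * ((W * 2) ^ 2 * C)) := by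
    intro n
    refine (integral_abs_le_sqrt_integral_sq (hTL n)).trans (Real.sqrt_le_sqrt ?_)
    rw [h.innovation.integral_sq_sum_mul h.memLp_innovation h.mean_innovation (ham n) (haL n),
      h.integral_sq_innovation, mul_one]
    calc _ ≤ ∑ i ∈ Finset.range n, (W * 2) ^ 2 * C := by
          refine Finset.sum_le_sum fun i _ ↦ ?_
          simp only [ha, mul_pow _ (_ / _)]
          rw [integral_const_mul]
          refine mul_le_mul ?_ (hC i) (integral_nonneg fun ω ↦ sq_nonneg _) (sq_nonneg _)
          refine sq_le_sq.2 ?_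
          rw [abs_mul, abs_mul, abs_mul, abs_two, abs_of_nonneg (arWeight_nonneg θ σ n i)]
          have h1 := h.arWeight_le n i
          have h2 := arWeight_nonneg θ σ n i
          have h3 := h.abs_lt_one
          rw [abs_of_nonneg (h2.trans h1)]
          exact mul_le_mul h1 (by linarith) (by positivity) (h2.trans h1)
      _ = _ := by simp
  have hX0 := h.memLp_zero.integrable_sq
  set e0 := ∫ ω, X 0 ω ^ 2 ∂μ with he0
  -- The source term of `X t ^ 2`, after division by `σ t ^ 2`, is `ζ² + 2θ (X/σ) ζ`. Centering `ζ²`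
  -- gives `S`, the cross term gives `T`.
  have hdecomp : ∀ n ω, ∑ t ∈ Finset.Ico 1 n, (X t ω / σ t) ^ 2
      - ∑ t ∈ Finset.Ico 1 n, 1 / σ t ^ 2 * ∫ ω, X t ω ^ 2 ∂μ
      = (X 0 ω ^ 2 - e0) * arInitWeight θ σ n + S n ω + T n ω := by
    intro n ω
    rw [h.sum_integral_div_sq_eq n]
    have e1 : ∑ t ∈ Finset.Ico 1 n, (X t ω / σ t) ^ 2
        = ∑ t ∈ Finset.Ico 1 n, 1 / σ t ^ 2 * X t ω ^ 2 :=
      Finset.sum_congr rfl fun t _ ↦ by rw [div_pow]; ring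
    rw [e1, sum_div_sq_eq_of_linear_recursion (D := fun t ↦ X t ω ^ 2)
      (p := fun t ↦ ζ t ω ^ 2 + 2 * θ * (X t ω / σ t) * ζ t ω) (fun t ↦ by
        have := (h.pos t).ne'
        rw [h.succ]; field_simp; ring)]
    simp only [hS, hT, ha, sub_mul, mul_sub, mul_add, mul_one, Finset.sum_sub_distrib,
      Finset.sum_add_distrib]
    have : ∑ x ∈ Finset.range n, arWeight θ σ n x * (2 * θ * (X x ω / σ x) * ζ x ω)
        = ∑ x ∈ Finset.range n, arWeight θ σ n x * (2 * θ) * (X x ω / σ x) * ζ x ω :=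
      Finset.sum_congr rfl fun t _ ↦ by ring
    rw [this]
    ring
  have hbound : ∀ n : ℕ, ∫ ω, |∑ t ∈ Finset.Ico 1 n, (X t ω / σ t) ^ 2
      - ∑ t ∈ Finset.Ico 1 n, 1 / σ t ^ 2 * ∫ ω, X t ω ^ 2 ∂μ| ∂μ
      ≤ (∫ ω, |X 0 ω ^ 2 - e0| ∂μ) * I + ∫ ω, |S n ω| ∂μ + √(n * ((W * 2) ^ 2 * C)) := by
    intro n
    have i1 : Integrable (fun ω ↦ |X 0 ω ^ 2 - e0| * I) μ :=
      ((hX0.sub (integrable_const _)).abs.mul_const I)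
    have i2 : Integrable (fun ω ↦ |S n ω|) μ := (hSi n).abs
    have i3 : Integrable (fun ω ↦ |T n ω|) μ := ((hTL n).integrable (by norm_num)).abs
    simp_rw [hdecomp]
    calc _ ≤ ∫ ω, (|X 0 ω ^ 2 - e0| * I + |S n ω| + |T n ω|) ∂μ := by
          refine integral_mono_of_nonneg (ae_of_all _ fun ω ↦ abs_nonneg _) ((i1.add i2).add i3)
            (ae_of_all _ fun ω ↦ ?_)
          refine (abs_add_le _ _).trans (add_le_add ((abs_add_le _ _).trans
            (add_le_add ?_ le_rfl)) le_rfl)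
          rw [abs_mul, abs_of_nonneg (arInitWeight_nonneg θ σ n)]
          exact mul_le_mul_of_nonneg_left (h.arInitWeight_le n) (abs_nonneg _)
      _ = (∫ ω, |X 0 ω ^ 2 - e0| ∂μ) * I + ∫ ω, |S n ω| ∂μ + ∫ ω, |T n ω| ∂μ := by
          have i12 : Integrable (fun ω ↦ |X 0 ω ^ 2 - e0| * I + |S n ω|) μ := i1.add i2
          rw [integral_add i12 i3, integral_add i1 i2, integral_mul_const]
      _ ≤ _ := add_le_add le_rfl (hTb n)
  have hlim1 : Tendsto (fun n : ℕ ↦ (∫ ω, |X 0 ω ^ 2 - e0| ∂μ) * I / n) atTop (𝓝 0) :=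
    tendsto_const_div_atTop_nhds_zero_nat _
  have hlim3 : Tendsto (fun n : ℕ ↦ √(n * ((W * 2) ^ 2 * C)) / n) atTop (𝓝 0) := by
    have : Tendsto (fun n : ℕ ↦ √(((W * 2) ^ 2 * C) / n)) atTop (𝓝 0) := by
      simpa using (tendsto_const_div_atTop_nhds_zero_nat ((W * 2) ^ 2 * C)).sqrt
    refine this.congr' ?_
    filter_upwards [eventually_gt_atTop 0] with n hn
    have hn' : (0 : ℝ) < n := by exact_mod_cast hn
    rw [show (n : ℝ) * ((W * 2) ^ 2 * C) = n ^ 2 * ((W * 2) ^ 2 * C / n) by field_simp,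
      Real.sqrt_mul (by positivity), Real.sqrt_sq hn'.le]
    field_simp
  refine squeeze_zero (fun n ↦ div_nonneg (integral_nonneg fun ω ↦ abs_nonneg _) n.cast_nonneg)
    (fun n ↦ div_le_div_of_nonneg_right (hbound n) n.cast_nonneg) ?_
  simp_rw [add_div]
  simpa using (hlim1.add hSlim).add hlim3

end Moments

end IsAdaptedAR1

/-! ### Asymptotic normality of the self-normalized error -/

/-- The difference of the two sequences tends to `0` in probability. This allows modifying an
estimator on events of vanishing probability. -/
lemma MeasureTheory.TendstoInDistribution.of_tendsto_measure_ne
    {Ω Ω' : Type*} {mΩ : MeasurableSpace Ω} {mΩ' : MeasurableSpace Ω'} {μ : Measure Ω}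
    {μ' : Measure Ω'} [IsProbabilityMeasure μ] [IsProbabilityMeasure μ']
    {R S : ℕ → Ω → ℝ} {Z : Ω' → ℝ} (hS : TendstoInDistribution S atTop Z (fun _ ↦ μ) μ')
    (hR : ∀ n, AEMeasurable (R n) μ) (hne : Tendsto (fun n ↦ μ {ω | R n ω ≠ S n ω}) atTop (𝓝 0)) :
    TendstoInDistribution R atTop Z (fun _ ↦ μ) μ' := by
  refine tendstoInDistribution_of_tendstoInMeasure_sub R Z hS ?_ hR
  rw [tendstoInMeasure_iff_norm]
  intro e he
  refine tendsto_of_tendsto_of_tendsto_of_le_of_le tendsto_const_nhds hne (fun _ ↦ zero_le)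
    fun n ↦ measure_mono fun ω hω ↦ ?_
  simp only [Pi.sub_apply, Pi.zero_apply, sub_zero] at hω
  intro heq
  have : e ≤ 0 := by simpa [heq] using hω
  linarith

lemma tendstoInMeasure_of_tendsto_integral_abs_sub
    {Ω : Type*} {mΩ : MeasurableSpace Ω} {μ : Measure Ω} [IsProbabilityMeasure μ]
    {V : ℕ → Ω → ℝ} {c : ℝ} (hi : ∀ n, Integrable (V n) μ)
    (h : Tendsto (fun n ↦ ∫ ω, |V n ω - c| ∂μ) atTop (𝓝 0)) :
    TendstoInMeasure μ V atTop (fun _ ↦ c) := by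
  rw [tendstoInMeasure_iff_measureReal_norm]
  intro e he
  refine squeeze_zero (fun _ ↦ measureReal_nonneg) (fun n ↦ ?_)
    (by simpa using h.div_const e)
  rw [le_div_iff₀ he, mul_comm]
  exact mul_meas_ge_le_integral_of_nonneg (ae_of_all _ fun ω ↦ abs_nonneg _)
    ((hi n).sub (integrable_const c)).abs e

namespace IsAdaptedAR1

variable {Ω : Type*} {mΩ : MeasurableSpace Ω} {μ : Measure Ω} {ℱ : Filtration ℕ mΩ}
  {θ M : ℝ} {σ : ℕ → ℝ} {ζ X : ℕ → Ω → ℝ}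

/-- The expected weighted sum of squares. -/
def infoSum (μ : Measure Ω) (σ : ℕ → ℝ) (X : ℕ → Ω → ℝ) (n : ℕ) : ℝ :=
  ∑ t ∈ Finset.Ico 1 n, 1 / σ t ^ 2 * ∫ ω, X t ω ^ 2 ∂μ

lemma infoSum_nonneg (μ : Measure Ω) (σ : ℕ → ℝ) (X : ℕ → Ω → ℝ) (n : ℕ) :
    0 ≤ infoSum μ σ X n :=
  Finset.sum_nonneg fun _ _ ↦ mul_nonneg (by positivity) (integral_nonneg fun _ ↦ sq_nonneg _)

variable [IsProbabilityMeasure μ]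

lemma tendstoInMeasure_sum_sq (h : IsAdaptedAR1 μ ℱ θ M σ ζ X) {c : ℝ} (hc : 0 < c)
    (hinfo : ∀ᶠ n : ℕ in atTop, c * n ≤ infoSum μ σ X n) :
    TendstoInMeasure μ (fun n ω ↦ (∑ t ∈ Finset.Ico 1 n, (X t ω / σ t) ^ 2) / infoSum μ σ X n)
      atTop (fun _ ↦ 1) := by
  refine tendstoInMeasure_of_tendsto_integral_abs_sub
    (fun n ↦ (integrable_finsetSum _ fun t _ ↦ (h.memLp_div t).integrable_sq).div_const _) ?_
  have hlim := h.tendsto_integral_abs_sum_sub_div.div_const c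
  rw [zero_div] at hlim
  refine squeeze_zero' (Eventually.of_forall fun n ↦ integral_nonneg fun ω ↦ abs_nonneg _) ?_ hlim
  filter_upwards [hinfo, eventually_gt_atTop 0] with n hn hn0
  have hn0' : (0 : ℝ) < n := by exact_mod_cast hn0
  have hQ : 0 < infoSum μ σ X n := (by positivity : 0 < c * n).trans_le hn
  have : ∀ ω, |(∑ t ∈ Finset.Ico 1 n, (X t ω / σ t) ^ 2) / infoSum μ σ X n - 1|
      = |∑ t ∈ Finset.Ico 1 n, (X t ω / σ t) ^ 2 - infoSum μ σ X n| / infoSum μ σ X n := by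
    intro ω
    rw [div_sub_one hQ.ne', abs_div, abs_of_pos hQ]
  simp_rw [this]
  rw [integral_div, div_div]
  refine div_le_div_of_nonneg_left (integral_nonneg fun ω ↦ abs_nonneg _) (by positivity) ?_
  linarith

lemma tendstoInDistribution_score (h : IsAdaptedAR1 μ ℱ θ M σ ζ X) {c : ℝ} (hc : 0 < c)
    (hinfo : ∀ᶠ n : ℕ in atTop, c * n ≤ infoSum μ σ X n) :
    TendstoInDistribution (fun n ω ↦
        (∑ t ∈ Finset.Ico 1 n, X t ω / σ t * ζ t ω) / √(infoSum μ σ X n))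
      atTop (id : ℝ → ℝ) (fun _ ↦ μ) (gaussianReal 0 1) := by
  -- The score starts at `t = 1`, the limit theorem at `t = 0`; the extra term is set to zero.
  set Y : ℕ → ℕ → Ω → ℝ := fun n t ω ↦
    if 1 ≤ t then X t ω / σ t / √(infoSum μ σ X n) else 0 with hY
  have hYm : ∀ n t, Measurable[ℱ t] (Y n t) := by
    intro n t
    by_cases ht : 1 ≤ t
    · simp only [hY, if_pos ht]
      exact ((h.measurable_adapted t).div_const _).div_const _
    · simp only [hY, if_neg ht]
      exact measurable_const
  have hYL : ∀ n t, MemLp (Y n t) 2 μ := by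
    intro n t
    by_cases ht : 1 ≤ t
    · simp only [hY, if_pos ht]
      simpa only [div_eq_inv_mul] using (h.memLp_div t).const_mul (√(infoSum μ σ X n))⁻¹
    · simp only [hY, if_neg ht]
      exact memLp_const 0
  have hrange : ∀ (n : ℕ) (f : ℕ → ℝ), (∀ t, ¬ 1 ≤ t → f t = 0) →
      ∑ t ∈ Finset.range n, f t = ∑ t ∈ Finset.Ico 1 n, f t := by
    intro n f hf
    refine (Finset.sum_subset (fun t ht ↦ ?_) fun t ht ht' ↦ hf t ?_).symm
    · simp at ht ⊢; omega
    · simp at ht ht'; omega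
  have hsq : ∀ n t, 1 ≤ t → ∀ ω, Y n t ω ^ 2 = (X t ω / σ t) ^ 2 / infoSum μ σ X n := by
    intro n t ht ω
    simp only [hY, if_pos ht]
    rw [div_pow _ (√_), Real.sq_sqrt (infoSum_nonneg μ σ X n)]
  have hzero : ∀ n t, ¬ 1 ≤ t → ∀ ω, Y n t ω = 0 := fun n t ht ω ↦ if_neg ht
  have hS : (fun n ω ↦ (∑ t ∈ Finset.Ico 1 n, X t ω / σ t * ζ t ω) / √(infoSum μ σ X n))
      = fun n ω ↦ ∑ t ∈ Finset.range n, Y n t ω * ζ t ω := by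
    ext n ω
    rw [hrange n (fun t ↦ Y n t ω * ζ t ω) fun t ht ↦ by rw [hzero n t ht, zero_mul],
      Finset.sum_div]
    refine Finset.sum_congr rfl fun t ht ↦ ?_
    simp only [hY, if_pos (Finset.mem_Ico.1 ht).1]
    ring
  have hV : (fun n ω ↦ ∑ t ∈ Finset.range n, Y n t ω ^ 2)
      = fun n ω ↦ (∑ t ∈ Finset.Ico 1 n, (X t ω / σ t) ^ 2) / infoSum μ σ X n := by
    ext n ω
    rw [hrange n (fun t ↦ Y n t ω ^ 2) fun t ht ↦ by rw [hzero n t ht]; ring,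
      Finset.sum_div]
    exact Finset.sum_congr rfl fun t ht ↦ hsq n t (Finset.mem_Ico.1 ht).1 ω
  rw [hS]
  refine h.innovation.tendstoInDistribution_sum_mul h.mean_innovation h.integral_sq_innovation
    hYm hYL (C := 1) ?_ ?_ ?_
  · refine Eventually.of_forall fun n ↦ ?_
    rw [hrange n (fun t ↦ ∫ ω, Y n t ω ^ 2 ∂μ) fun t ht ↦ by simp [hzero n t ht]]
    calc _ = ∑ t ∈ Finset.Ico 1 n, (1 / σ t ^ 2 * ∫ ω, X t ω ^ 2 ∂μ) / infoSum μ σ X n := by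
          refine Finset.sum_congr rfl fun t ht ↦ ?_
          simp_rw [hsq n t (Finset.mem_Ico.1 ht).1]
          rw [integral_div, ← integral_const_mul]
          congr 2 with ω
          rw [div_pow]; ring
      _ = infoSum μ σ X n / infoSum μ σ X n := by rw [← Finset.sum_div]; rfl
      _ ≤ 1 := div_self_le_one _
  · intro η hη
    rw [Metric.tendsto_nhds]
    intro e he
    -- There are at most `n` terms, each at most `c * (e / 2) / (c * n)` once the threshold `η *
    -- √Q`, which is at least `η * √(c * n)`, exceeds `A`.
    obtain ⟨A, hA, hAb⟩ := h.exists_setIntegral_div_sq_le (δ := c * (e / 2)) (by positivity)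
    have hgrow : Tendsto (fun n : ℕ ↦ η * √(c * n)) atTop atTop :=
      (Real.tendsto_sqrt_atTop.comp
        (tendsto_natCast_atTop_atTop.const_mul_atTop hc)).const_mul_atTop hη
    filter_upwards [hinfo, eventually_gt_atTop 0, hgrow.eventually_ge_atTop A] with n hn hn0 hnA
    have hn0' : (0 : ℝ) < n := by exact_mod_cast hn0
    have hcn : 0 < c * n := by positivity
    have hQ : 0 < infoSum μ σ X n := hcn.trans_le hn
    have hnn : 0 ≤ ∑ t ∈ Finset.range n, ∫ ω in {ω | η < |Y n t ω|}, Y n t ω ^ 2 ∂μ :=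
      Finset.sum_nonneg fun t _ ↦ integral_nonneg fun ω ↦ sq_nonneg _
    rw [Real.dist_eq, sub_zero, abs_of_nonneg hnn]
    rw [hrange n (fun t ↦ ∫ ω in {ω | η < |Y n t ω|}, Y n t ω ^ 2 ∂μ) fun t ht ↦ by
      simp [hzero n t ht]]
    calc _ ≤ ∑ t ∈ Finset.Ico 1 n, c * (e / 2) / (c * n) := by
          refine Finset.sum_le_sum fun t ht ↦ ?_
          have ht1 := (Finset.mem_Ico.1 ht).1
          have hset : {ω | η < |Y n t ω|} = {ω | η * √(infoSum μ σ X n) < |X t ω / σ t|} := by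
            ext ω
            simp only [hY, if_pos ht1, Set.mem_ofPred_eq]
            rw [abs_div (_ / _), abs_of_nonneg (Real.sqrt_nonneg _),
              lt_div_iff₀ (Real.sqrt_pos.2 hQ)]
          rw [hset]
          simp_rw [hsq n t ht1]
          rw [integral_div]
          refine div_le_div₀ (by positivity) (hAb _ (hnA.trans ?_) t) hcn hn
          gcongr
      _ ≤ n * (c * (e / 2) / (c * n)) := by
          rw [Finset.sum_const, Nat.card_Ico, nsmul_eq_mul]
          gcongr
          exact_mod_cast Nat.sub_le n 1
      _ = e / 2 := by field_simp
      _ < e := half_lt_self he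
  · rw [hV]
    exact h.tendstoInMeasure_sum_sq hc hinfo

/-- Asymptotic normality of the self-normalized estimation error: it suffices that the error `r n`
solves the normal equation almost surely. -/
lemma tendstoInDistribution_sqrt_infoSum_mul (h : IsAdaptedAR1 μ ℱ θ M σ ζ X) {c : ℝ} (hc : 0 < c)
    (hinfo : ∀ᶠ n : ℕ in atTop, c * n ≤ infoSum μ σ X n) {r : ℕ → Ω → ℝ}
    (hr : ∀ n, AEMeasurable (r n) μ)
    (hnormal : ∀ n, ∀ᵐ ω ∂μ, 0 < ∑ t ∈ Finset.Ico 1 n, (X t ω / σ t) ^ 2 →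
      r n ω * ∑ t ∈ Finset.Ico 1 n, (X t ω / σ t) ^ 2
        = ∑ t ∈ Finset.Ico 1 n, X t ω / σ t * ζ t ω) :
    TendstoInDistribution (fun n ω ↦ √(infoSum μ σ X n) * r n ω) atTop (id : ℝ → ℝ)
      (fun _ ↦ μ) (gaussianReal 0 1) := by
  have hV := h.tendstoInMeasure_sum_sq hc hinfo
  have hVm : ∀ n, Measurable fun ω ↦
      (∑ t ∈ Finset.Ico 1 n, (X t ω / σ t) ^ 2) / infoSum μ σ X n := fun n ↦
    (Finset.measurable_fun_sum _ fun t _ ↦ ((h.measurable t).div_const _).pow_const 2).div_const _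
  -- The maximum makes the quotient continuous everywhere. It changes the value only when `V / Q <
  -- 1/2`, an event of vanishing probability.
  have hcont : Continuous fun p : ℝ × ℝ ↦ p.1 / max p.2 (1 / 2) := by
    refine continuous_fst.div (continuous_snd.max continuous_const) fun p ↦ ?_
    exact (lt_max_of_lt_right (by norm_num)).ne'
  have hslut := (h.tendstoInDistribution_score hc
    hinfo).continuous_comp_prodMk_of_tendstoInMeasure_const hcont hV fun n ↦ (hVm n).aemeasurable
  have hlimit : (fun x : ℝ ↦ id x / max (1 : ℝ) (1 / 2)) = id := by
    ext x; rw [max_eq_left (by norm_num)]; simp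
  simp only [hlimit] at hslut
  refine hslut.of_tendsto_measure_ne (fun n ↦ (hr n).const_mul _) ?_
  rw [tendstoInMeasure_iff_norm] at hV
  refine tendsto_of_tendsto_of_tendsto_of_le_of_le' tendsto_const_nhds (hV (1 / 2) (by norm_num))
    (Eventually.of_forall fun _ ↦ zero_le) ?_
  filter_upwards [hinfo, eventually_gt_atTop 0] with n hn hn0
  have hn0' : (0 : ℝ) < n := by exact_mod_cast hn0
  have hQ : 0 < infoSum μ σ X n := (by positivity : 0 < c * n).trans_le hn
  refine measure_mono_ae ?_
  filter_upwards [hnormal n] with ω hω hne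
  change 1 / 2 ≤ ‖(∑ t ∈ Finset.Ico 1 n, (X t ω / σ t) ^ 2) / infoSum μ σ X n - 1‖
  by_contra hlt
  rw [not_le, Real.norm_eq_abs, abs_lt] at hlt
  have hVpos : 1 / 2 < (∑ t ∈ Finset.Ico 1 n, (X t ω / σ t) ^ 2) / infoSum μ σ X n := by
    linarith [hlt.1]
  have hDpos : 0 < ∑ t ∈ Finset.Ico 1 n, (X t ω / σ t) ^ 2 := by
    have := (lt_div_iff₀ hQ).1 hVpos
    linarith
  refine hne ?_
  rw [← hω hDpos, max_eq_left hVpos.le]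
  generalize ∑ t ∈ Finset.Ico 1 n, (X t ω / σ t) ^ 2 = D at hDpos
  have hs : √(infoSum μ σ X n) ≠ 0 := (Real.sqrt_pos.2 hQ).ne'
  field_simp
  rw [Real.sq_sqrt hQ.le, mul_comm]

end IsAdaptedAR1

lemma MeasureTheory.TendstoInDistribution.gaussianReal_mul_of_tendsto
    {Ω : Type*} {mΩ : MeasurableSpace Ω} {μ : Measure Ω} [IsProbabilityMeasure μ]
    {R : ℕ → Ω → ℝ} {a : ℕ → ℝ} {c v : ℝ}
    (hR : TendstoInDistribution R atTop (id : ℝ → ℝ) (fun _ ↦ μ) (gaussianReal 0 1))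
    (ha : Tendsto a atTop (𝓝 c)) (hcv : c ^ 2 = v) :
    TendstoInDistribution (fun n ω ↦ a n * R n ω) atTop (id : ℝ → ℝ) (fun _ ↦ μ)
      (gaussianReal 0 v.toNNReal) := by
  have haM : TendstoInMeasure μ (fun n (_ : Ω) ↦ a n) atTop (fun _ ↦ c) :=
    tendstoInMeasure_of_tendsto_ae (fun n ↦ aestronglyMeasurable_const) (ae_of_all _ fun _ ↦ ha)
  have h := hR.continuous_comp_prodMk_of_tendstoInMeasure_const
    (g := fun p : ℝ × ℝ ↦ p.2 * p.1) (by fun_prop) haM fun n ↦ aemeasurable_const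
  refine ⟨h.forall_aemeasurable, aemeasurable_id, ?_⟩
  have hmap : (gaussianReal 0 1).map (fun x ↦ c * id x) = (gaussianReal 0 v.toNNReal).map id := by
    have := gaussianReal_map_const_mul (μ := 0) (v := 1) c
    rw [Measure.map_id]
    simp only [id]
    rw [this]
    congr 1
    · simp
    · ext; simp [← hcv, sq_nonneg]
  convert! h.tendsto using 1
  exact congrArg 𝓝 (Subtype.ext hmap.symm)

/-- The normal equation for a minimizer of a weighted least squares criterion. -/
lemma mul_sum_sq_eq_of_forall_sum_sq_le {ι : Type*} {s : Finset ι} {x y : ι → ℝ} {b : ℝ}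
    (hmin : ∀ b', ∑ t ∈ s, (y t - b * x t) ^ 2 ≤ ∑ t ∈ s, (y t - b' * x t) ^ 2)
    (hpos : 0 < ∑ t ∈ s, x t ^ 2) : b * ∑ t ∈ s, x t ^ 2 = ∑ t ∈ s, x t * y t := by
  have hexp : ∀ b', ∑ t ∈ s, (y t - b' * x t) ^ 2
      = ∑ t ∈ s, y t ^ 2 - 2 * b' * ∑ t ∈ s, x t * y t + b' ^ 2 * ∑ t ∈ s, x t ^ 2 := by
    intro b'
    rw [Finset.mul_sum, Finset.mul_sum, ← Finset.sum_sub_distrib, ← Finset.sum_add_distrib]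
    exact Finset.sum_congr rfl fun t _ ↦ by ring
  set D := ∑ t ∈ s, x t ^ 2
  set G := ∑ t ∈ s, x t * y t
  -- Comparison with the vertex of the parabola alone suffices: the gap times `D` is `(b * D - G) ^
  -- 2`.
  have h := hmin (G / D)
  rw [hexp, hexp] at h
  have h2 : (b * D - G) ^ 2 ≤ 0 := by
    have e : (b * D - G) ^ 2
        = D * ((-2 * b * G + b ^ 2 * D) - (-2 * (G / D) * G + (G / D) ^ 2 * D)) := by
      field_simp; ring
    rw [e]
    exact mul_nonpos_of_nonneg_of_nonpos hpos.le (by linarith)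
  have := pow_eq_zero_iff two_ne_zero |>.1 (le_antisymm h2 (sq_nonneg _))
  linarith

/-! ### Reduction of the model and proof of the theorem -/

section Model

variable {Ω : Type*} [mΩ : MeasurableSpace Ω] {μ : Measure Ω}
    {θ₀ : ℝ} {τ : ℕ → ℝ} {ε X : ℕ → Ω → ℝ} {θhat : ℕ → Ω → ℝ}

/-- The innovation `(X_{t+1} - θ₀ X_t) / τ_{t+1}` recovered from the observations. -/
def recoveredInnovation (θ₀ : ℝ) (τ : ℕ → ℝ) (X : ℕ → Ω → ℝ) (t : ℕ) (ω : Ω) : ℝ :=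
  (X (t + 1) ω - θ₀ * X t ω) / τ (t + 1)

/-- The given recursion holds only almost surely, and `ε` need not be adapted to the natural
filtration of `X`. The recovered innovations agree with `ε` almost surely, are adapted, and satisfy
the recursion at every point. The maximum with `1` covers `i = j`, which (A1) omits. -/
lemma IsHeteroscedasticAR1.isAdaptedAR1 (h : IsHeteroscedasticAR1 μ θ₀ τ ε X) {M₂ : ℝ}
    (hA1 : ∀ i j : ℕ, 1 ≤ i → i < j → τ i / τ j ≤ M₂) :
    IsAdaptedAR1 μ (Filtration.natural X fun t ↦ (h.measurable_X t).stronglyMeasurable) θ₀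
      (max M₂ 1) (fun t ↦ τ (t + 1)) (recoveredInnovation θ₀ τ X) X := by
  set ℱ := Filtration.natural X fun t ↦ (h.measurable_X t).stronglyMeasurable with hℱ
  have hτ : ∀ t, 0 < τ (t + 1) := fun t ↦ h.tau_pos (t + 1) (by omega)
  have hae : ∀ t, recoveredInnovation θ₀ τ X t =ᵐ[μ] ε (t + 1) := by
    intro t
    filter_upwards [h.recursion t] with ω hω
    have := (hτ t).ne'
    rw [recoveredInnovation, hω]
    field_simp
    ring
  have hXm : ∀ t, Measurable[ℱ t] (X t) := fun t ↦
    (Filtration.stronglyAdapted_natural (fun t ↦ (h.measurable_X t).stronglyMeasurable)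
      t).measurable
  have hrm : ∀ t, Measurable[ℱ (t + 1)] (recoveredInnovation θ₀ τ X t) := fun t ↦
    ((hXm (t + 1)).sub (((hXm t).mono (ℱ.mono (Nat.le_succ t)) le_rfl).const_mul θ₀)).div_const _
  have hrm' : ∀ t, Measurable (recoveredInnovation θ₀ τ X t) := fun t ↦
    (hrm t).mono (ℱ.le _) le_rfl
  have hid : ∀ t, IdentDistrib (recoveredInnovation θ₀ τ X t) (ε 1) μ μ := fun t ↦
    (IdentDistrib.of_ae_eq (hrm' t).aemeasurable (hae t)).trans
      (h.identDistrib_eps (t + 1) (by omega))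
  have hmean := (hid 0).integral_eq.trans h.mean_eps
  have hmem := (hid 0).memLp_iff.2 h.memLp_eps
  refine
    { abs_lt_one := h.abs_theta_lt_one
      pos := hτ
      le_mul := fun i j hij ↦ ?_
      innovation := ⟨hrm, fun t ↦ ?_, fun t ↦ (hid t).trans (hid 0).symm⟩
      memLp_innovation := hmem
      mean_innovation := hmean
      integral_sq_innovation := ?_
      measurable_adapted := hXm
      memLp_zero := by exact_mod_cast h.memLp_X_zero 2
      succ := fun t ω ↦ ?_ }
  · rcases hij.eq_or_lt with rfl | hlt
    · exact le_mul_of_one_le_left (hτ i).le (le_max_right _ _)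
    · rw [← div_le_iff₀ (hτ j)]
      exact (hA1 (i + 1) (j + 1) (by omega) (by omega)).trans (le_max_left _ _)
  · have hind : IndepFun (fun ω (k : Fin (t + 1)) ↦ X k ω) (recoveredInnovation θ₀ τ X t) μ :=
      ((h.indepFun_past (t + 1) (by omega)).symm).congr ae_eq_rfl (hae t).symm
    rw [IndepFun_iff_Indep] at hind
    refine indep_of_indep_of_le_left hind ?_
    rw [hℱ]
    refine iSup₂_le fun j hj ↦ ?_
    rw [← measurable_iff_comap_le]
    · have hc : Measurable[MeasurableSpace.comap (fun ω (k : Fin (t + 1)) ↦ X k ω) inferInstance]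
          (fun ω (k : Fin (t + 1)) ↦ X k ω) := comap_measurable _
      have := (measurable_pi_apply (⟨j, by omega⟩ : Fin (t + 1))).comp hc
      simpa [Function.comp_def, BorelSpace.measurable_eq] using this
  · rw [← variance_of_integral_eq_zero (hrm' 0).aemeasurable hmean, (hid 0).variance_eq,
      h.variance_eps]
  · have := (hτ t).ne'
    rw [recoveredInnovation]
    field_simp
    ring

lemma sum_Icc_two_eq (f : ℕ → ℝ) (n : ℕ) :
    ∑ t ∈ Finset.Icc 2 n, f t = ∑ t ∈ Finset.Ico 1 n, f (t + 1) := by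
  rw [Finset.sum_Ico_add' f 1 n 1]
  congr 1

lemma sNorm_eq (μ : Measure Ω) (τ : ℕ → ℝ) (X : ℕ → Ω → ℝ) (n : ℕ) :
    sNorm μ τ X n = √(IsAdaptedAR1.infoSum μ (fun t ↦ τ (t + 1)) X n) := by
  rw [sNorm, sum_Icc_two_eq]
  rfl

/-- Shift both indices by one and exchange the sums; the lag `t - i = (t - 1 - i) + 1` releases the
factor `θ ^ 2`. -/
lemma ratioAverage_eq (θ : ℝ) (τ : ℕ → ℝ) (n : ℕ) :
    ratioAverage θ τ n
      = 1 / n * (θ ^ 2 * ∑ i ∈ Finset.range n, arWeight θ (fun t ↦ τ (t + 1)) n i) := by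
  rw [ratioAverage]
  congr 1
  have e1 : Finset.Icc 1 n = Finset.Ico (0 + 1) (n + 1) := rfl
  rw [e1, ← Finset.sum_Ico_add' (fun j ↦ ∑ i ∈ Finset.Ico 1 j,
    θ ^ (2 * (j - i)) * (τ i / τ j) ^ 2) 0 n 1, Finset.mul_sum]
  simp_rw [arWeight, Finset.mul_sum]
  rw [← Finset.sum_comm' (s := Finset.Ico 0 n) (t := fun t ↦ Finset.Ico 0 t)
    (f := fun t i ↦ θ ^ 2 * ((θ ^ 2) ^ (t - 1 - i) * (τ (i + 1) / τ (t + 1)) ^ 2))]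
  · refine Finset.sum_congr rfl fun t _ ↦ ?_
    rw [show Finset.Ico 1 (t + 1) = Finset.Ico (0 + 1) (t + 1) from rfl,
      ← Finset.sum_Ico_add' (fun i ↦ θ ^ (2 * (t + 1 - i)) * (τ i / τ (t + 1)) ^ 2) 0 t 1]
    refine Finset.sum_congr rfl fun i hi ↦ ?_
    rw [Finset.mem_Ico] at hi
    rw [← mul_assoc, ← pow_succ', ← pow_mul]
    congr 3
    omega
  · intro t i
    simp only [Finset.mem_Ico, Finset.mem_range]
    omega

/-- Dividing by `τ (t + 1)` turns the criterion into ordinary least squares; subtracting `θ₀`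
replaces the response by the innovation. -/
lemma IsWLSEstimator.ae_normal_equation (hθ : IsWLSEstimator μ τ X θhat)
    (hτ : ∀ t, 1 ≤ t → 0 < τ t) (n : ℕ) :
    ∀ᵐ ω ∂μ, 0 < ∑ t ∈ Finset.Ico 1 n, (X t ω / τ (t + 1)) ^ 2 →
      (θhat n ω - θ₀) * ∑ t ∈ Finset.Ico 1 n, (X t ω / τ (t + 1)) ^ 2
        = ∑ t ∈ Finset.Ico 1 n, X t ω / τ (t + 1) * recoveredInnovation θ₀ τ X t ω := by
  filter_upwards [hθ.minimizes n] with ω hω hpos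
  have hn : 0 < n := by
    rcases Nat.eq_zero_or_pos n with rfl | hn
    · simp at hpos
    · exact hn
  have hn' : (0 : ℝ) < n := by exact_mod_cast hn
  have hcrit : ∀ b, wlsCriterion τ (fun t ↦ X t ω) n b = 1 / n *
      ∑ t ∈ Finset.Ico 1 n, (X (t + 1) ω / τ (t + 1) - b * (X t ω / τ (t + 1))) ^ 2 := by
    intro b
    rw [wlsCriterion, sum_Icc_two_eq]
    congr 1
    refine Finset.sum_congr rfl fun t _ ↦ ?_
    have := (hτ (t + 1) (by omega)).ne'
    rw [Nat.add_sub_cancel]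
    field_simp
  have hmin := mul_sum_sq_eq_of_forall_sum_sq_le (s := Finset.Ico 1 n) (b := θhat n ω)
    (x := fun t ↦ X t ω / τ (t + 1)) (y := fun t ↦ X (t + 1) ω / τ (t + 1)) (fun b ↦ by
      have := hω b
      rw [hcrit, hcrit] at this
      exact le_of_mul_le_mul_left this (by positivity)) hpos
  rw [sub_mul, hmin, Finset.mul_sum, ← Finset.sum_sub_distrib]
  refine Finset.sum_congr rfl fun t _ ↦ ?_
  rw [recoveredInnovation]
  ring

end Model

end

theorem theorem4 {Ω : Type*} [MeasurableSpace Ω] (μ : Measure Ω) [IsProbabilityMeasure μ]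
    (θ₀ : ℝ) (τ : ℕ → ℝ) (ε X : ℕ → Ω → ℝ) (θhat : ℕ → Ω → ℝ)
    (hmodel : IsHeteroscedasticAR1 μ θ₀ τ ε X)
    (hθhat : IsWLSEstimator μ τ X θhat)
    (hA1 : ∃ M₂ : ℝ, ∀ i j : ℕ, 1 ≤ i → i < j → τ i / τ j ≤ M₂)
    (hA2 : ∃ M₁ : ℝ, 0 < M₁ ∧ ∀ᶠ n : ℕ in atTop, M₁ ≤ ratioAverage θ₀ τ n) :
    TendstoInDistribution (fun (n : ℕ) ω ↦ sNorm μ τ X n * (θhat n ω - θ₀))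
        atTop (id : ℝ → ℝ) (fun _ ↦ μ) (gaussianReal 0 1) ∧
      ∀ ρ : ℝ, Tendsto (ratioAverage θ₀ τ) atTop (𝓝 (ρ ^ 2)) →
        TendstoInDistribution (fun (n : ℕ) ω ↦ Real.sqrt n * (θhat n ω - θ₀))
          atTop (id : ℝ → ℝ) (fun _ ↦ μ) (gaussianReal 0 (Real.toNNReal (θ₀ ^ 2 / ρ ^ 2))) := by
  obtain ⟨M₂, hM₂⟩ := hA1
  obtain ⟨M₁, hM₁, hM₁b⟩ := hA2
  have h := hmodel.isAdaptedAR1 hM₂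
  set σ : ℕ → ℝ := fun t ↦ τ (t + 1) with hσ
  set Q := IsAdaptedAR1.infoSum μ σ X with hQdef
  set e0 := ∫ ω, X 0 ω ^ 2 ∂μ with he0
  have he0n : 0 ≤ e0 := integral_nonneg fun _ ↦ sq_nonneg _
  -- For `θ₀ = 0` the average in (A2) vanishes identically, contradicting its positive lower bound.
  have hθ0 : θ₀ ≠ 0 := by
    rintro rfl
    obtain ⟨n, hn⟩ := hM₁b.exists
    rw [ratioAverage_eq] at hn
    simp at hn
    linarith
  have hθ2 : 0 < θ₀ ^ 2 := by positivity
  -- The initial value contributes only a bounded amount; the rest is the average in (A2) and (A3).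
  -- Positivity of `n` cancels its factor `1 / n`.
  have hQ : ∀ n : ℕ, 0 < n → Q n = e0 * arInitWeight θ₀ σ n + n * ratioAverage θ₀ τ n / θ₀ ^ 2 := by
    intro n hn
    have hn' : (n : ℝ) ≠ 0 := by positivity
    rw [ratioAverage_eq, hQdef, IsAdaptedAR1.infoSum, h.sum_integral_div_sq_eq n, ← hσ, ← he0]
    field_simp
  have hinfo : ∀ᶠ n : ℕ in atTop, M₁ / θ₀ ^ 2 * n ≤ Q n := by
    filter_upwards [hM₁b, eventually_gt_atTop 0] with n hn hn0
    rw [hQ n hn0]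
    have h1 : M₁ / θ₀ ^ 2 * n ≤ n * ratioAverage θ₀ τ n / θ₀ ^ 2 := by
      rw [div_mul_eq_mul_div, mul_comm M₁]
      gcongr
    have := mul_nonneg he0n (arInitWeight_nonneg θ₀ σ n)
    linarith
  have hr : ∀ n, AEMeasurable (fun ω ↦ θhat n ω - θ₀) μ := fun n ↦
    (hθhat.aemeasurable n).sub_const θ₀
  have hmain := h.tendstoInDistribution_sqrt_infoSum_mul (by positivity) hinfo hr
    (hθhat.ae_normal_equation hmodel.tau_pos)
  refine ⟨by simpa only [sNorm_eq] using hmain, fun ρ hρ ↦ ?_⟩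
  have hρ2 : 0 < ρ ^ 2 := hM₁.trans_le (ge_of_tendsto hρ hM₁b)
  have hQlim : Tendsto (fun n : ℕ ↦ Q n / n) atTop (𝓝 (ρ ^ 2 / θ₀ ^ 2)) := by
    have hinit : Tendsto (fun n : ℕ ↦ e0 * arInitWeight θ₀ σ n / n) atTop (𝓝 0) := by
      refine squeeze_zero (fun n ↦ div_nonneg (mul_nonneg he0n (arInitWeight_nonneg θ₀ σ n))
        n.cast_nonneg) (fun n ↦ ?_) (tendsto_const_div_atTop_nhds_zero_nat
          (e0 * ((max M₂ 1 / σ 0) ^ 2 * (1 - θ₀ ^ 2)⁻¹)))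
      exact div_le_div_of_nonneg_right (mul_le_mul_of_nonneg_left (h.arInitWeight_le n) he0n)
        n.cast_nonneg
    have hsum := hinit.add (hρ.div_const (θ₀ ^ 2))
    rw [zero_add] at hsum
    refine hsum.congr' ?_
    filter_upwards [eventually_gt_atTop 0] with n hn
    have hn' : (n : ℝ) ≠ 0 := by positivity
    rw [hQ n hn]
    field_simp
  have hscale : Tendsto (fun n : ℕ ↦ (√(Q n / n))⁻¹) atTop (𝓝 (√(ρ ^ 2 / θ₀ ^ 2))⁻¹) :=
    hQlim.sqrt.inv₀ (Real.sqrt_pos.2 (by positivity)).ne'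
  have hfin := hmain.gaussianReal_mul_of_tendsto hscale (v := θ₀ ^ 2 / ρ ^ 2) (by
    rw [inv_pow, Real.sq_sqrt (by positivity), inv_div])
  refine hfin.of_tendsto_measure_ne (fun n ↦ (hr n).const_mul _) ?_
  -- For large `n` one has `Q n > 0`, and the two expressions agree everywhere.
  refine tendsto_const_nhds.congr' ?_
  filter_upwards [hinfo, eventually_gt_atTop 0] with n hn hn0
  have hn' : (0 : ℝ) < n := by exact_mod_cast hn0
  have hQpos : 0 < Q n := (by positivity : 0 < M₁ / θ₀ ^ 2 * n).trans_le hn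
  have hset : {ω | √(n : ℝ) * (θhat n ω - θ₀)
      ≠ (√(Q n / n))⁻¹ * (√(Q n) * (θhat n ω - θ₀))} = ∅ := by
    ext ω
    simp only [Set.mem_ofPred_eq, Set.mem_empty_iff_false, iff_false, not_not]
    rw [Real.sqrt_div hQpos.le, inv_div]
    have := (Real.sqrt_pos.2 hQpos).ne'
    field_simp
  rw [hset, measure_empty]
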